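/- Let $M$ be a two-dimensional $C^r$ manifold, $r\ge 4$ an integer, let $U\subset M$ be open, and let $R:U\to U$ be a $C^r$ involution ($R\circ R=\mathrm{id}$). Let $f$ be a $C^r$ map, defined on $U$, that is reversible with respect to $R$, i.e. $f\circ R\circ f=R$ (equivalently $R\circ f\circ R=f^{-1}$) wherever $z$ and $f(z)$ lie in $U$. Let $O$ be a periodic point of $f$ of period $n\ge 1$ (a fixed point if $n=1$) whose orbit lies in $U$, such that $R(O)=O$ and such that, near $O$, the fixed point set $\mathrm{Fix}(R)$ is a $C^r$ curve (a one-dimensional submanifold). Put $T_0=f^n$, and suppose that $O$ is a saddle of $T_0$ with multipliers (eigenvalues of $DT_0(O)$) $\lambda$ and $\lambda^{-1}$, where $\lambda\in\mathbb R$, $0<|\lambda|<1$. Then there are $C^{r-1}$ local coordinates $(x,y)$ near $O$, with $O$ at the origin, such that, near the origin: 1. $T_0:(x,y)\mapsto(\bar x,\bar y)$ has the form $$\bar x=\lambda x\,(1+h_1(x,y)\,xy),\qquad \bar y=\lambda^{-1}y\,(1+h_2(x,y)\,xy),$$ where $h_1,h_2$ are continuous functions and $h_1(0,0)=-h_2(0,0)$.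 2. The involution $R$ takes the form $L(x,y)=(y,x)$, and the map in these coordinates is reversible with respect to $L$: $T_0\circ L\circ T_0=L$. 3. $T_0$ has an equivalent cross-form: there is a continuous function $\hat h$ such that, for all $(x,y)$ and $(\bar x,\bar y)$ sufficiently close to the origin, $(\bar x,\bar y)=T_0(x,y)$ if and only if $$\bar x=\lambda x+\hat h(x,\bar y)\,x^2\bar y,\qquad y=\lambda\bar y+\hat h(\bar y,x)\,x\bar y^2 .$$ -/

import Mathlib

open Set Filter Topology Manifold

namespace ReversibleSaddle

section Surfaces

variable {M : Type*} [TopologicalSpace M] [ChartedSpace (ℝ × ℝ) M]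

/-- `e` is a system of `C^k` local coordinates on the surface `M` centred at `p`:
a homeomorphism from an open neighbourhood of `p` onto an open subset of the plane
which is `C^k`-compatible with the charts of `M`, and which sends `p` to the origin. -/
def IsLocalCoord (k : ℕ) (e : OpenPartialHomeomorph M (ℝ × ℝ)) (p : M) : Prop :=
  e ∈ IsManifold.maximalAtlas 𝓘(ℝ, ℝ × ℝ) (k : WithTop ℕ∞) M ∧ p ∈ e.source ∧ e p = 0

/-- Near its point `p`, the set `S` is a one-dimensional `C^k` submanifold of the surface `M`:
in suitable `C^k` local coordinates `(s, t)` it is the line `t = 0`. -/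
def IsCurveNear (k : ℕ) (S : Set M) (p : M) : Prop :=
  ∃ e : OpenPartialHomeomorph M (ℝ × ℝ), IsLocalCoord k e p ∧
    ∀ z ∈ e.source, z ∈ S ↔ (e z).2 = 0

/-- The map `T` written in the local coordinates `e`. -/
def inCoord (e : OpenPartialHomeomorph M (ℝ × ℝ)) (T : M → M) : ℝ × ℝ → ℝ × ℝ :=
  fun p => e (T (e.symm p))

/-- `μ` is a (real) multiplier of the map `T` at the fixed point `p`, that is, an eigenvalue of
the differential of `T` at `p`, computed in a chart at `p`. -/
def IsMultiplier (T : M → M) (p : M) (μ : ℝ) : Prop :=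
  Module.End.HasEigenvalue
    (fderiv ℝ (inCoord (chartAt (ℝ × ℝ) p) T) (chartAt (ℝ × ℝ) p p)).toLinearMap μ

/-- On the open set `U`, the map `f` and the involution `R` are of class `C^k`, and `f` is
reversible with respect to `R`: `f ∘ R ∘ f = R` wherever the left side makes sense in `U`
(equivalently, `R ∘ f ∘ R = f⁻¹`). -/
structure IsReversibleOn (k : ℕ) (f R : M → M) (U : Set M) : Prop where
  isOpen : IsOpen U
  contMDiffOn_map : ContMDiffOn 𝓘(ℝ, ℝ × ℝ) 𝓘(ℝ, ℝ × ℝ) (k : WithTop ℕ∞) f U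
  contMDiffOn_rev : ContMDiffOn 𝓘(ℝ, ℝ × ℝ) 𝓘(ℝ, ℝ × ℝ) (k : WithTop ℕ∞) R U
  mapsTo_rev : MapsTo R U U
  involutive : ∀ z ∈ U, R (R z) = z
  reversible : ∀ z ∈ U, f z ∈ U → f (R (f z)) = R z

end Surfaces

/-- Near the origin, the planar map `F` is `x̄ = a x (1 + h₁(x,y) x y)`,
`ȳ = a⁻¹ y (1 + h₂(x,y) x y)`. -/
def HasMainNormalForm (F : ℝ × ℝ → ℝ × ℝ) (a : ℝ) (h₁ h₂ : ℝ × ℝ → ℝ) : Prop :=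
  ∀ᶠ p in 𝓝 (0 : ℝ × ℝ),
    F p = (a * p.1 * (1 + h₁ p * (p.1 * p.2)), a⁻¹ * p.2 * (1 + h₂ p * (p.1 * p.2)))

/-- For `(x, y)` and `(x̄, ȳ)` near the origin, the relation `(x̄, ȳ) = F (x, y)` is equivalent to
the cross-form equations `x̄ = a x + h(x,ȳ) x² ȳ`, `y = a ȳ + h(ȳ,x) x ȳ²`. -/
def HasCrossForm (F : ℝ × ℝ → ℝ × ℝ) (a : ℝ) (h : ℝ × ℝ → ℝ) : Prop :=
  ∀ᶠ q in 𝓝 (0 : (ℝ × ℝ) × (ℝ × ℝ)),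
    q.2 = F q.1 ↔
      q.2.1 = a * q.1.1 + h (q.1.1, q.2.2) * (q.1.1 ^ 2 * q.2.2) ∧
      q.1.2 = a * q.2.2 + h (q.2.2, q.1.1) * (q.1.1 * q.2.2 ^ 2)

end ReversibleSaddle

/-!
Everything takes place in a chart centred at `O`, where `T₀` is a reversible planar germ `F` with
involution `ρ`. Three changes of coordinates, each compatible with the involution, bring `F` to its
normal form.

* Averaging over the involution makes `ρ` the swap `(x, y) ↦ (y, x)`. Reversibility makes the
  differential of the involution carry the eigenvector for `a` to one for `a⁻¹`, so that `DF(0)`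
  becomes diagonal (`exists_linearizing_coordinates`).
* The stable manifold has a `C^r` parametrization `K` with `F (K s) = K (a s)`
  (`exists_invariant_curve`), and its mirror image parametrizes the unstable manifold. The
  coordinates `(x, y) ↦ K x + swap (K y)` straighten both manifolds and linearize `F` on them
  (`exists_straightening_coordinates`).
* The coordinates `(x β(y), y β(x))` make `∂x̄/∂x` equal to `a` along the `y`-axis; `β` solves a
  multiplicative cohomological equation with data of class `C^(r-1)`
  (`exists_normal_multiplier_coordinates`). This is the only step that loses a derivative.

After that, `x̄ - a x` vanishes on both axes, to second order on the `y`-axis, and has class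
`C^(r-1)` with `r - 1 ≥ 3`; so it is a continuous multiple of `x² y` (`exists_eq_mul_sq_mul`).
Reversibility says that `F` maps `(ȳ, x̄)` to `(y, x)`. The formula for the first component thus
yields the second one, the relation `h₁(0) = -h₂(0)`, and both cross-form equations.

The smoothness of `K` and `β` rests on one principle for functional equations
`u s = N s (u (a s)) + P s (u s) + b s` that contract at `s = 0`: they have continuous solutions,
and every continuous solution is as smooth as the coefficients (`exists_linear_solution`,
`contDiffAt_solution`). For `K` the equation is that of its second derivative, for `β` that of the
derivative of its logarithm.
-/

namespace ReversibleSaddle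

/-! ### Linear functional equations in one variable -/

lemma eventually_forall_abs_le {p : ℝ → Prop} (h : ∀ᶠ s in 𝓝 (0 : ℝ), p s) :
    ∀ᶠ δ in 𝓝[>] (0 : ℝ), 0 < δ ∧ ∀ s, |s| ≤ δ → p s := by
  obtain ⟨ε, hε, h⟩ := Metric.eventually_nhds_iff.1 h
  filter_upwards [Ioo_mem_nhdsGT hε] with δ hδ
  refine ⟨hδ.1, fun s hs => h ?_⟩
  rw [Real.dist_eq, sub_zero]
  exact hs.trans_lt hδ.2

lemma eventually_comp_mul {p : ℝ → Prop} (a : ℝ) (h : ∀ᶠ s in 𝓝 (0 : ℝ), p s) :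
    ∀ᶠ s in 𝓝 (0 : ℝ), p (a * s) := by
  have : Tendsto (fun s : ℝ => a * s) (𝓝 0) (𝓝 0) := by
    have := (continuous_const_mul a).tendsto (0 : ℝ)
    rwa [mul_zero] at this
  exact this.eventually h

/-- A contraction principle for operators on bounded continuous curves which only see the interval
`[-δ, δ]`: the fixed-point equation is solved there, and the fixed point is a continuous curve on
the whole line. The operator is composed with the retraction of `ℝ` onto `[-δ, δ]` and iterated in
the ball of radius `C` of the bounded continuous functions. -/
lemma exists_fixed_curve {E : Type*} [NormedAddCommGroup E] [CompleteSpace E] {δ C κ : ℝ}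
    (hδ : 0 ≤ δ) (hC : 0 ≤ C)
    (hκ : 0 ≤ κ) (hκ1 : κ < 1) (T : (ℝ → E) → ℝ → E)
    (hcont : ∀ z, Continuous z → (∀ s, ‖z s‖ ≤ C) → ContinuousOn (T z) (Icc (-δ) δ))
    (hmaps : ∀ z, Continuous z → (∀ s, ‖z s‖ ≤ C) → ∀ s, |s| ≤ δ → ‖T z s‖ ≤ C)
    (hlip : ∀ z w, Continuous z → (∀ s, ‖z s‖ ≤ C) → Continuous w → (∀ s, ‖w s‖ ≤ C) →
      ∀ D, (∀ s, ‖z s - w s‖ ≤ D) → ∀ s, |s| ≤ δ → ‖T z s - T w s‖ ≤ κ * D) :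
    ∃ z : ℝ → E, Continuous z ∧ ∀ s, |s| ≤ δ → z s = T z s := by
  let c : ℝ → ℝ := fun s => max (-δ) (min s δ)
  have hc : Continuous c := by fun_prop
  have hcI : ∀ s, c s ∈ Icc (-δ) δ := fun s =>
    ⟨le_max_left _ _, max_le (by linarith) (min_le_right _ _)⟩
  have hcabs : ∀ s, |c s| ≤ δ := fun s => abs_le.2 (hcI s)
  have hcid : ∀ s, |s| ≤ δ → c s = s := fun s hs => by
    rw [abs_le] at hs
    simp only [c, min_eq_left hs.2, max_eq_right hs.1]
  let X := Metric.closedBall (0 : BoundedContinuousFunction ℝ E) C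
  have hX : ∀ z : X, ∀ s, ‖z.1 s‖ ≤ C := fun z s => by
    have := z.2
    rw [Metric.mem_closedBall, dist_zero_right] at this
    exact (z.1.norm_coe_le_norm s).trans this
  have : CompleteSpace X := Metric.isClosed_closedBall.completeSpace_coe
  have : Nonempty X := ⟨⟨0, Metric.mem_closedBall_self hC⟩⟩
  let S : X → X := fun z =>
    ⟨BoundedContinuousFunction.ofNormedAddCommGroup (fun s => T z.1 (c s))
      ((hcont z.1 z.1.continuous (hX z)).comp_continuous hc hcI) C
      (fun s => hmaps z.1 z.1.continuous (hX z) _ (hcabs s)), by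
      rw [Metric.mem_closedBall, dist_zero_right, BoundedContinuousFunction.norm_le hC]
      exact fun s => hmaps z.1 z.1.continuous (hX z) _ (hcabs s)⟩
  have hS : ContractingWith ⟨κ, hκ⟩ S := by
    refine ⟨by exact_mod_cast hκ1, LipschitzWith.of_dist_le_mul fun z w => ?_⟩
    rw [Subtype.dist_eq, BoundedContinuousFunction.dist_le (by positivity)]
    intro s
    rw [dist_eq_norm]
    refine hlip z.1 w.1 z.1.continuous (hX z) w.1.continuous (hX w) _ (fun t => ?_) _ (hcabs s)
    rw [← dist_eq_norm]
    exact BoundedContinuousFunction.dist_coe_le_dist t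
  have hfix := hS.fixedPoint_isFixedPt
  refine ⟨(ContractingWith.fixedPoint S hS).1, (ContractingWith.fixedPoint S hS).1.continuous,
    fun s hs => ?_⟩
  conv_lhs => rw [← hfix]
  show T _ (c s) = _
  rw [hcid s hs]

variable {E : Type*} [NormedAddCommGroup E] [NormedSpace ℝ E]

lemma abs_mul_le_of_abs_le {a s δ : ℝ} (ha : |a| < 1) (hs : |s| ≤ δ) : |a * s| ≤ δ := by
  rw [abs_mul]
  nlinarith [abs_nonneg a, abs_nonneg s]

/-- The functional equation `v s = N s (v (a s)) + P s (v s) + b s`, contracting at `s = 0`, has a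
continuous solution near `0`. -/
lemma exists_linear_solution [CompleteSpace E] {a : ℝ} {N P : ℝ → E →L[ℝ] E}
    {b : ℝ → E}
    (hN : ContDiffAt ℝ 0 N 0) (hP : ContDiffAt ℝ 0 P 0) (hb : ContDiffAt ℝ 0 b 0)
    (h1 : ‖N 0‖ + ‖P 0‖ < 1) :
    ∃ v : ℝ → E, Continuous v ∧ ∀ᶠ s in 𝓝 0, v s = N s (v (a * s)) + P s (v s) + b s := by
  obtain ⟨κ, hκ1, hκ2⟩ := exists_between h1
  have hκ : 0 ≤ κ := by linarith [norm_nonneg (N 0), norm_nonneg (P 0)]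
  have e1 : ∀ᶠ s in 𝓝 (0 : ℝ), ‖N s‖ + ‖P s‖ < κ :=
    (hN.continuousAt.norm.add hP.continuousAt.norm).eventually_lt_const hκ1
  have e2 : ∀ᶠ s in 𝓝 (0 : ℝ), ‖b s‖ < ‖b 0‖ + 1 :=
    hb.continuousAt.norm.eventually_lt_const (by linarith)
  have c1 := (hN.eventually (by simp)).and ((hP.eventually (by simp)).and (hb.eventually (by simp)))
  obtain ⟨δ, hδ, H⟩ := (eventually_forall_abs_le (e1.and (e2.and c1))).exists
  have hC : 0 ≤ (‖b 0‖ + 1) / (1 - κ) := div_nonneg (by positivity) (by linarith)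
  have hC' : κ * ((‖b 0‖ + 1) / (1 - κ)) + (‖b 0‖ + 1) = (‖b 0‖ + 1) / (1 - κ) := by
    have : 1 - κ ≠ 0 := by linarith
    field_simp
    ring
  refine (exists_fixed_curve hδ.le hC hκ hκ2
    (fun v s => N s (v (a * s)) + P s (v s) + b s) ?_ ?_ ?_).imp fun v hv => ⟨hv.1, ?_⟩
  · intro z hz _ s hs
    obtain ⟨-, -, h3, h4, h5⟩ := H s (abs_le.2 hs)
    have := h3.continuousAt
    have := h4.continuousAt
    have := h5.continuousAt
    exact ContinuousAt.continuousWithinAt (by fun_prop)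
  · intro z _ hzC s hs
    obtain ⟨h1, h2, -⟩ := H s hs
    calc ‖N s (z (a * s)) + P s (z s) + b s‖
        ≤ ‖N s‖ * ‖z (a * s)‖ + ‖P s‖ * ‖z s‖ + ‖b s‖ :=
          norm_add₃_le.trans (by gcongr <;> exact ContinuousLinearMap.le_opNorm _ _)
      _ ≤ ‖N s‖ * ((‖b 0‖ + 1) / (1 - κ)) + ‖P s‖ * ((‖b 0‖ + 1) / (1 - κ)) + (‖b 0‖ + 1) := by
          gcongr <;> apply hzC
      _ = (‖N s‖ + ‖P s‖) * ((‖b 0‖ + 1) / (1 - κ)) + (‖b 0‖ + 1) := by ring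
      _ ≤ κ * ((‖b 0‖ + 1) / (1 - κ)) + (‖b 0‖ + 1) := by gcongr
      _ = _ := hC'
  · intro z w _ _ _ _ D hD s hs
    obtain ⟨h1, -⟩ := H s hs
    have hD0 : 0 ≤ D := (norm_nonneg _).trans (hD 0)
    calc ‖N s (z (a * s)) + P s (z s) + b s - (N s (w (a * s)) + P s (w s) + b s)‖
        = ‖N s (z (a * s) - w (a * s)) + P s (z s - w s)‖ := by
          simp only [map_sub]; congr 1; abel
      _ ≤ ‖N s‖ * ‖z (a * s) - w (a * s)‖ + ‖P s‖ * ‖z s - w s‖ :=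
          (norm_add_le _ _).trans (by gcongr <;> exact ContinuousLinearMap.le_opNorm _ _)
      _ ≤ ‖N s‖ * D + ‖P s‖ * D := by gcongr <;> apply hD
      _ = (‖N s‖ + ‖P s‖) * D := by ring
      _ ≤ κ * D := by gcongr
  · filter_upwards [Icc_mem_nhds (neg_lt_zero.2 hδ) hδ] with s hs
    exact hv.2 s (abs_le.2 hs)

lemma contDiffAt_succ_of_hasDerivAt {f f' : ℝ → E} {x : ℝ} {n : ℕ}
    (h : ∀ᶠ s in 𝓝 x, HasDerivAt f (f' s) s) (hf' : ContDiffAt ℝ n f' x) :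
    ContDiffAt ℝ (n + 1 : ℕ) f x := by
  push_cast
  rw [contDiffAt_succ_iff_hasFDerivAt]
  refine ⟨fun s => ContinuousLinearMap.smulRightL ℝ ℝ E (1 : ℝ →L[ℝ] ℝ) (f' s),
    ⟨_, h, fun s hs => ?_⟩, ?_⟩
  · have : HasDerivAt f (f' s) s := hs
    exact this.hasFDerivAt.congr_fderiv (by ext; simp)
  · exact (ContinuousLinearMap.contDiff _).contDiffAt.comp x hf'

lemma hasDerivAt_integral [CompleteSpace E] {v : ℝ → E} (hv : Continuous v) (s : ℝ) :
    HasDerivAt (fun u => ∫ t in (0 : ℝ)..u, v t) (v s) s :=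
  (hv.integral_hasStrictDerivAt 0 s).hasDerivAt

/-- A continuous solution `u` of the functional equation is differentiable near `0`, with derivative
any continuous solution `v` of the formally differentiated equation. The primitive `w` of `v` with
`w 0 = u 0` satisfies the equation for `u` up to an error `e` whose derivative is linear in `w - u`;
hence `sup |w - u| ≤ (κ + C δ) sup |w - u|` on `[-δ, δ]`, which forces `w = u` for small `δ`. -/
lemma hasDerivAt_solution [CompleteSpace E] {a : ℝ} (ha : |a| < 1) {N P N' P' : ℝ → E →L[ℝ] E}
    {b b' u v : ℝ → E}
    (hN : ∀ᶠ s in 𝓝 0, HasDerivAt N (N' s) s) (hP : ∀ᶠ s in 𝓝 0, HasDerivAt P (P' s) s)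
    (hb : ∀ᶠ s in 𝓝 0, HasDerivAt b (b' s) s)
    (hN' : ContinuousAt N' 0) (hP' : ContinuousAt P' 0)
    (h1 : ‖N 0‖ + ‖P 0‖ < 1) (hu : ContDiffAt ℝ 0 u 0)
    (hu' : ∀ᶠ s in 𝓝 0, u s = N s (u (a * s)) + P s (u s) + b s) (hv : Continuous v)
    (hv' : ∀ᶠ s in 𝓝 0, v s = N s (a • v (a * s)) + P s (v s) +
      (N' s (u (a * s)) + P' s (u s) + b' s)) :
    ∀ᶠ s in 𝓝 0, HasDerivAt u (v s) s := by
  obtain ⟨κ, hκ1, hκ2⟩ := exists_between h1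
  have hNc : ContinuousAt N 0 := hN.self_of_nhds.continuousAt
  have hPc : ContinuousAt P 0 := hP.self_of_nhds.continuousAt
  have e1 : ∀ᶠ s in 𝓝 (0 : ℝ), ‖N s‖ + ‖P s‖ < κ :=
    (hNc.norm.add hPc.norm).eventually_lt_const hκ1
  set C := ‖N' 0‖ + ‖P' 0‖ + 1 with hCdef
  have e2 : ∀ᶠ s in 𝓝 (0 : ℝ), ‖N' s‖ + ‖P' s‖ < C :=
    (hN'.norm.add hP'.norm).eventually_lt_const (lt_add_one _)
  have e3 : ∀ᶠ δ in 𝓝[>] (0 : ℝ), κ + C * δ < 1 := by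
    have : ContinuousAt (fun δ : ℝ => κ + C * δ) 0 := by fun_prop
    exact (this.eventually_lt_const (by simpa using hκ2)).filter_mono nhdsWithin_le_nhds
  obtain ⟨δ, ⟨hδ, H⟩, hδ3⟩ := ((eventually_forall_abs_le (e1.and (e2.and (hN.and (hP.and
    (hb.and ((hu.eventually (by simp)).and (hu'.and hv')))))))).and e3).exists
  set w : ℝ → E := fun s => u 0 + ∫ t in (0 : ℝ)..s, v t with hwdef
  have hw : ∀ s, HasDerivAt w (v s) s := fun s => (hasDerivAt_integral hv s).const_add _
  have hw0 : w 0 = u 0 := by simp [hwdef]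
  -- the defect of `w` in the functional equation
  set e : ℝ → E := fun s => N s (w (a * s)) + P s (w s) + b s - w s with hedef
  have he0 : e 0 = 0 := by
    have := hu'.self_of_nhds
    rw [mul_zero] at this
    simp only [hedef, mul_zero, hw0, ← this, sub_self]
  have he : ∀ s, |s| ≤ δ → HasDerivAt e (N' s (w (a * s) - u (a * s)) + P' s (w s - u s)) s := by
    intro s hs
    obtain ⟨-, -, hN, hP, hb, -, -, hv⟩ := H s hs
    have hwa : HasDerivAt (fun s => w (a * s)) (a • v (a * s)) s :=
      (hw (a * s)).scomp s (by simpa using (hasDerivAt_id s).const_mul a)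
    have := (((hN.clm_apply hwa).add (hP.clm_apply (hw s))).add hb).sub (hw s)
    refine this.congr_deriv ?_
    generalize P s (v s) = q at hv ⊢
    rw [hv]
    simp only [map_sub]
    abel
  have hIcc : ∀ {s : ℝ}, s ∈ Icc (-δ) δ ↔ |s| ≤ δ := abs_le.symm
  obtain ⟨s₀, hs₀, hmax⟩ := (isCompact_Icc (a := -δ) (b := δ)).exists_isMaxOn
    ⟨0, hIcc.2 (by simpa using hδ.le)⟩ (f := fun s => ‖w s - u s‖) (fun s hs => by
      have h1 := (H s (hIcc.1 hs)).2.2.2.2.2.1.continuousAt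
      have h2 := (hw s).continuousAt
      exact ContinuousAt.continuousWithinAt (by fun_prop))
  set D := ‖w s₀ - u s₀‖
  have hD : ∀ s, |s| ≤ δ → ‖w s - u s‖ ≤ D := fun s hs => hmax (hIcc.2 hs)
  have hD0 : 0 ≤ D := norm_nonneg _
  have hC0 : 0 ≤ C := by positivity
  have heb : ∀ s, |s| ≤ δ → ‖e s‖ ≤ C * D * δ := by
    intro s hs
    have := Convex.norm_image_sub_le_of_norm_hasDerivWithin_le (C := C * D) (f := e)
      (s := Icc (-δ) δ) (x := 0) (y := s)
      (fun t ht => (he t (hIcc.1 ht)).hasDerivWithinAt) (fun t ht => ?_) (convex_Icc _ _)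
      (hIcc.2 (by simpa using hδ.le)) (hIcc.2 hs)
    · rw [he0, sub_zero, sub_zero, Real.norm_eq_abs] at this
      exact this.trans (by gcongr)
    · rw [hIcc] at ht
      calc _ ≤ ‖N' t‖ * ‖w (a * t) - u (a * t)‖ + ‖P' t‖ * ‖w t - u t‖ :=
            (norm_add_le _ _).trans (by gcongr <;> exact ContinuousLinearMap.le_opNorm _ _)
        _ ≤ ‖N' t‖ * D + ‖P' t‖ * D := by
            gcongr
            exacts [hD _ (abs_mul_le_of_abs_le ha ht), hD _ ht]
        _ = (‖N' t‖ + ‖P' t‖) * D := by ring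
        _ ≤ C * D := by gcongr; exact (H t ht).2.1.le
  have hD1 : D ≤ (κ + C * δ) * D := by
    have hs := hIcc.1 hs₀
    calc D = ‖N s₀ (w (a * s₀) - u (a * s₀)) + P s₀ (w s₀ - u s₀) - e s₀‖ := by
          have := (H s₀ hs).2.2.2.2.2.2.1
          show ‖w s₀ - u s₀‖ = _
          congr 1
          conv_lhs => rw [this]
          simp only [hedef, map_sub]
          abel
      _ ≤ ‖N s₀‖ * ‖w (a * s₀) - u (a * s₀)‖ + ‖P s₀‖ * ‖w s₀ - u s₀‖ + ‖e s₀‖ :=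
          (norm_sub_le _ _).trans (add_le_add ((norm_add_le _ _).trans
            (by gcongr <;> exact ContinuousLinearMap.le_opNorm _ _)) le_rfl)
      _ ≤ ‖N s₀‖ * D + ‖P s₀‖ * D + C * D * δ := by
          gcongr
          exacts [hD _ (abs_mul_le_of_abs_le ha hs), heb _ hs]
      _ = (‖N s₀‖ + ‖P s₀‖ + C * δ) * D := by ring
      _ ≤ (κ + C * δ) * D := by gcongr; exact (H s₀ hs).1.le
  have hDz : D = 0 := by nlinarith
  have hwu : w =ᶠ[𝓝 0] u := by
    filter_upwards [Icc_mem_nhds (neg_lt_zero.2 hδ) hδ] with s hs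
    have := hD s (hIcc.1 hs)
    rw [hDz] at this
    exact sub_eq_zero.1 (norm_le_zero_iff.1 this)
  filter_upwards [hwu.eventuallyEq_nhds] with s hs
  exact (hw s).congr_of_eventuallyEq hs.symm

/-- Regularity for linear functional equations: a continuous solution is as smooth as the
coefficients. Its derivative solves an equation of the same kind, with one derivative less in the
data and with `N` replaced by the smaller `a • N`, so induction applies. -/
lemma contDiffAt_solution [CompleteSpace E] {a : ℝ} (ha : |a| < 1) (j : ℕ)
    {N P : ℝ → E →L[ℝ] E} {b u : ℝ → E}
    (hN : ContDiffAt ℝ j N 0) (hP : ContDiffAt ℝ j P 0) (hb : ContDiffAt ℝ j b 0)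
    (h1 : ‖N 0‖ + ‖P 0‖ < 1) (hu : ContDiffAt ℝ 0 u 0)
    (hu' : ∀ᶠ s in 𝓝 0, u s = N s (u (a * s)) + P s (u s) + b s) :
    ContDiffAt ℝ j u 0 := by
  induction j generalizing N P b u with
  | zero => exact_mod_cast hu
  | succ j ih =>
    have hj : ((j : ℕ) : WithTop ℕ∞) ≤ (j + 1 : ℕ) := by exact_mod_cast j.le_succ
    have hj1 : ((j : ℕ) : WithTop ℕ∞) + 1 ≤ (j + 1 : ℕ) := by push_cast; exact le_rfl
    have huj : ContDiffAt ℝ j u 0 := ih (hN.of_le hj) (hP.of_le hj) (hb.of_le hj) h1 hu hu'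
    have hN' : ContDiffAt ℝ j (deriv N) 0 := hN.derivWithin hj1
    have hP' : ContDiffAt ℝ j (deriv P) 0 := hP.derivWithin hj1
    have hb' : ContDiffAt ℝ j (deriv b) 0 := hb.derivWithin hj1
    have hder : ∀ {G : Type _} [NormedAddCommGroup G] [NormedSpace ℝ G] {f : ℝ → G},
        ContDiffAt ℝ (j + 1 : ℕ) f 0 → ∀ᶠ s in 𝓝 0, HasDerivAt f (deriv f s) s := by
      intro G _ _ f hf
      filter_upwards [hf.eventually (by simp)] with s hs
      exact (hs.differentiableAt (by positivity)).hasDerivAt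
    have huaj : ContDiffAt ℝ j (fun s => u (a * s)) 0 :=
      ContDiffAt.comp (g := u) 0 (by simpa using huj) (by fun_prop)
    have hB : ContDiffAt ℝ j (fun s => deriv N s (u (a * s)) + deriv P s (u s) + deriv b s) 0 :=
      ((hN'.clm_apply huaj).add (hP'.clm_apply huj)).add hb'
    have h1' : ‖(a • N) 0‖ + ‖P 0‖ < 1 := by
      refine lt_of_le_of_lt ?_ h1
      gcongr
      rw [Pi.smul_apply, norm_smul, Real.norm_eq_abs]
      exact mul_le_of_le_one_left (norm_nonneg _) ha.le
    have haN : ContDiffAt ℝ j (a • N) 0 := contDiffAt_const.smul (hN.of_le hj)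
    obtain ⟨v, hv, hv'⟩ := exists_linear_solution (a := a) (haN.of_le (by simp))
      ((hP.of_le hj).of_le (by simp)) (hB.of_le (by simp)) h1'
    have hvj : ContDiffAt ℝ j v 0 :=
      ih haN (hP.of_le hj) hB h1' (contDiff_zero.2 hv).contDiffAt hv'
    refine contDiffAt_succ_of_hasDerivAt (hasDerivAt_solution ha (hder hN) (hder hP) (hder hb)
      hN'.continuousAt hP'.continuousAt h1 hu hu' hv ?_) hvj
    filter_upwards [hv'] with s hs
    rw [Pi.smul_apply, smul_apply] at hs
    rw [map_smul]
    exact hs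

/-! ### The linearized invariant curve -/

/-- The nonlinear functional equation satisfied by the second derivative `z` of an invariant curve
`k`. As `k` and `k'` are primitives of `z`, they depend on `z` with Lipschitz constant `O(δ)` on
`[-δ, δ]`; since `Q 0 = 0`, only the linear term `N`, of norm less than one, matters for small `δ`,
and the right-hand side is a contraction. -/
lemma exists_second_derivative_solution [CompleteSpace E] {a : ℝ} (c : E)
    {N : E →L[ℝ] E} {Q : E → E →L[ℝ] E} {B : E × E → E} (hN : ‖N‖ < 1)
    (hQ : ContDiffAt ℝ 1 Q 0) (hQ0 : Q 0 = 0) (hB : ContDiffAt ℝ 1 B (0, c)) :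
    ∃ z k k' : ℝ → E, Continuous z ∧ k 0 = 0 ∧ k' 0 = c ∧ (∀ s, HasDerivAt k (k' s) s) ∧
      (∀ s, HasDerivAt k' (z s) s) ∧
      ∀ᶠ s in 𝓝 0, z s = N (z (a * s)) + Q (k s) (z s) + B (k s, k' s) := by
  obtain ⟨Λ₁, t₁, ht₁, hL₁⟩ := hQ.exists_lipschitzOnWith
  obtain ⟨Λ₂, t₂, ht₂, hL₂⟩ := hB.exists_lipschitzOnWith
  obtain ⟨ε₁, hε₁, hb₁⟩ := Metric.mem_nhds_iff.1 ht₁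
  obtain ⟨ε₂, hε₂, hb₂⟩ := Metric.mem_nhds_iff.1 ht₂
  have hcQ : ∀ᶠ x in 𝓝 (0 : E), ContinuousAt Q x :=
    (hQ.eventually (by simp)).mono fun x hx => hx.continuousAt
  have hcB : ∀ᶠ x in 𝓝 ((0, c) : E × E), ContinuousAt B x :=
    (hB.eventually (by simp)).mono fun x hx => hx.continuousAt
  obtain ⟨ε₃, hε₃, hb₃⟩ := Metric.eventually_nhds_iff.1 hcQ
  obtain ⟨ε₄, hε₄, hb₄⟩ := Metric.eventually_nhds_iff.1 hcB
  obtain ⟨κ, hκ1, hκ2⟩ := exists_between hN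
  have hκ : 0 ≤ κ := (norm_nonneg _).trans hκ1.le
  set C : ℝ := (‖B (0, c)‖ + 1) / (1 - κ) with hCdef
  have hC : 0 ≤ C := div_nonneg (by positivity) (by linarith)
  have hC' : κ * C + (‖B (0, c)‖ + 1) = C := by
    have : 1 - κ ≠ 0 := by linarith
    rw [hCdef]
    field_simp
    ring
  -- apart from `0 < δ`, each condition on `δ` is a strict inequality that holds at `δ = 0`
  have small : ∀ {φ : ℝ → ℝ} {y : ℝ}, Continuous φ → φ 0 < y → ∀ᶠ δ in 𝓝[>] (0 : ℝ), φ δ < y :=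
    fun h h0 => ((h.tendsto 0).eventually_lt_const h0).filter_mono nhdsWithin_le_nhds
  set ε := min (min ε₁ ε₂) (min ε₃ ε₄) with hε
  have hmin : 0 < ε := by positivity
  obtain ⟨δ, hδ, h1δ, hV, hX, hQb, hBb, hLip⟩ :=
    ((eventually_mem_nhdsWithin (a := (0 : ℝ)) (s := Ioi 0)).and ((small (φ := fun δ => δ) (y := 1)
      (by fun_prop) (by simp)).and
    ((small (φ := fun δ => δ * C) (y := ε) (by fun_prop) (by simpa using hmin)).and
    ((small (φ := fun δ => δ * (‖c‖ + δ * C)) (y := ε) (by fun_prop) (by simpa using hmin)).and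
    ((small (φ := fun δ => ‖N‖ + Λ₁ * (δ * (‖c‖ + δ * C))) (y := κ) (by fun_prop)
      (by simpa using hκ1)).and
    ((small (φ := fun δ => Λ₂ * (δ * (‖c‖ + δ * C) + δ * C)) (y := 1) (by fun_prop)
      (by simp)).and
    (small (φ := fun δ => ‖N‖ + Λ₁ * (δ * (‖c‖ + δ * C)) + Λ₁ * δ * C + Λ₂ * δ) (y := κ)
      (by fun_prop) (by simpa using hκ1)))))))).exists
  rw [mem_Ioi] at hδ
  simp only [hε, lt_min_iff] at hV hX
  let V : (ℝ → E) → ℝ → E := fun z s => c + ∫ t in (0 : ℝ)..s, z t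
  let X : (ℝ → E) → ℝ → E := fun z s => ∫ t in (0 : ℝ)..s, V z t
  have hVd : ∀ z, Continuous z → ∀ s, HasDerivAt (V z) (z s) s := fun z hz s =>
    (hasDerivAt_integral hz s).const_add _
  have hVc : ∀ z, Continuous z → Continuous (V z) := fun z hz =>
    continuous_iff_continuousAt.2 fun s => (hVd z hz s).continuousAt
  have hXd : ∀ z, Continuous z → ∀ s, HasDerivAt (X z) (V z s) s := fun z hz s =>
    hasDerivAt_integral (hVc z hz) s
  have hint : ∀ {g : ℝ → E} {D : ℝ}, (∀ s, |s| ≤ δ → ‖g s‖ ≤ D) → ∀ s, |s| ≤ δ →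
      ‖∫ t in (0 : ℝ)..s, g t‖ ≤ δ * D := by
    intro g D hg s hs
    have hD0 : 0 ≤ D := (norm_nonneg _).trans (hg s hs)
    have := intervalIntegral.norm_integral_le_of_norm_le_const (a := 0) (b := s) (C := D) (f := g)
      (fun t ht => hg t ?_)
    · rw [sub_zero] at this
      nlinarith
    · have := Set.uIoc_subset_uIcc ht
      have h2 := abs_sub_left_of_mem_uIcc this
      simp only [sub_zero] at h2
      exact h2.trans hs
  have hVb : ∀ z, (∀ s, ‖z s‖ ≤ C) → ∀ s, |s| ≤ δ → ‖V z s - c‖ ≤ δ * C := by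
    intro z hz s hs
    simpa [V] using hint (fun s _ => hz s) s hs
  have hXb : ∀ z, (∀ s, ‖z s‖ ≤ C) → ∀ s, |s| ≤ δ → ‖X z s‖ ≤ δ * (‖c‖ + δ * C) := by
    intro z hz s hs
    refine hint (fun t ht => ?_) s hs
    have := norm_add_le c (V z t - c)
    rw [add_sub_cancel] at this
    exact this.trans (add_le_add le_rfl (hVb z hz t ht))
  have hVl : ∀ z w, Continuous z → Continuous w → ∀ D, (∀ s, ‖z s - w s‖ ≤ D) → ∀ s, |s| ≤ δ →
      ‖V z s - V w s‖ ≤ δ * D := by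
    intro z w hz hw D hD s hs
    have : V z s - V w s = ∫ t in (0 : ℝ)..s, (z t - w t) := by
      rw [intervalIntegral.integral_sub (hz.intervalIntegrable _ _) (hw.intervalIntegrable _ _)]
      simp [V]
    rw [this]
    exact hint (fun s _ => hD s) s hs
  have hXl : ∀ z w, Continuous z → Continuous w → ∀ D, (∀ s, ‖z s - w s‖ ≤ D) → ∀ s, |s| ≤ δ →
      ‖X z s - X w s‖ ≤ δ * D := by
    intro z w hz hw D hD s hs
    have hD0 : 0 ≤ D := (norm_nonneg _).trans (hD 0)
    have : X z s - X w s = ∫ t in (0 : ℝ)..s, (V z t - V w t) := by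
      rw [intervalIntegral.integral_sub ((hVc z hz).intervalIntegrable _ _)
        ((hVc w hw).intervalIntegrable _ _)]
    rw [this]
    refine (hint (fun s hs => hVl z w hz hw D hD s hs) s hs).trans ?_
    nlinarith [mul_nonneg hδ.le hD0]
  have hmem₁ : ∀ z, (∀ s, ‖z s‖ ≤ C) → ∀ s, |s| ≤ δ → X z s ∈ t₁ := fun z hz s hs =>
    hb₁ (by rw [mem_ball_zero_iff]; exact (hXb z hz s hs).trans_lt hX.1.1)
  have hdist : ∀ {ε : ℝ}, δ * C < ε → δ * (‖c‖ + δ * C) < ε → ∀ z, (∀ s, ‖z s‖ ≤ C) → ∀ s,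
      |s| ≤ δ → dist (X z s, V z s) (0, c) < ε := fun h1 h2 z hz s hs => by
    rw [Prod.dist_eq, max_lt_iff, dist_zero_right, dist_eq_norm]
    exact ⟨(hXb z hz s hs).trans_lt h2, (hVb z hz s hs).trans_lt h1⟩
  have hmem₂ : ∀ z, (∀ s, ‖z s‖ ≤ C) → ∀ s, |s| ≤ δ → (X z s, V z s) ∈ t₂ := fun z hz s hs =>
    hb₂ (hdist hV.1.2 hX.1.2 z hz s hs)
  have hQn : ∀ z, (∀ s, ‖z s‖ ≤ C) → ∀ s, |s| ≤ δ → ‖Q (X z s)‖ ≤ Λ₁ * (δ * (‖c‖ + δ * C)) := by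
    intro z hz s hs
    have := hL₁.dist_le_mul _ (hmem₁ z hz s hs) 0 (mem_of_mem_nhds ht₁)
    rw [hQ0, dist_zero_right, dist_zero_right] at this
    exact this.trans (by gcongr; exact hXb z hz s hs)
  obtain ⟨z, hz, hzeq⟩ := exists_fixed_curve hδ.le hC hκ hκ2
    (fun z s => N (z (a * s)) + Q (X z s) (z s) + B (X z s, V z s))
    (by
      intro z hz hzC s hs
      have hs := abs_le.2 hs
      have h1 : ContinuousAt Q (X z s) := hb₃ (by
        rw [dist_zero_right]; exact (hXb z hzC s hs).trans_lt hX.2.1)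
      have h2 : ContinuousAt B (X z s, V z s) := hb₄ (hdist hV.2.2 hX.2.2 z hzC s hs)
      have h3 := (hVc z hz).continuousAt (x := s)
      have h4 := (hXd z hz s).continuousAt
      have h5 : ContinuousAt (fun s => Q (X z s)) s := ContinuousAt.comp (g := Q) h1 h4
      have h6 : ContinuousAt (fun s => B (X z s, V z s)) s :=
        ContinuousAt.comp (g := B) (f := fun s => (X z s, V z s)) h2 (h4.prodMk h3)
      exact ContinuousAt.continuousWithinAt (by fun_prop))
    (by
      intro z _ hzC s hs
      have hBn : ‖B (X z s, V z s)‖ ≤ ‖B (0, c)‖ + 1 := by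
        have := hL₂.dist_le_mul _ (hmem₂ z hzC s hs) (0, c) (mem_of_mem_nhds ht₂)
        rw [Prod.dist_eq, dist_eq_norm, dist_zero_right, dist_eq_norm] at this
        have h2 : max ‖X z s‖ ‖V z s - c‖ ≤ δ * (‖c‖ + δ * C) + δ * C :=
          (max_le_add_of_nonneg (norm_nonneg _) (norm_nonneg _)).trans
            (add_le_add (hXb z hzC s hs) (hVb z hzC s hs))
        have h3 : ‖B (X z s, V z s) - B (0, c)‖ ≤ 1 :=
          this.trans ((mul_le_mul_of_nonneg_left h2 Λ₂.2).trans hBb.le)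
        have h4 := norm_add_le (B (0, c)) (B (X z s, V z s) - B (0, c))
        rw [add_sub_cancel] at h4
        linarith
      calc _ ≤ ‖N‖ * ‖z (a * s)‖ + ‖Q (X z s)‖ * ‖z s‖ + ‖B (X z s, V z s)‖ :=
            norm_add₃_le.trans (by gcongr <;> exact ContinuousLinearMap.le_opNorm _ _)
        _ ≤ ‖N‖ * C + (Λ₁ * (δ * (‖c‖ + δ * C))) * C + (‖B (0, c)‖ + 1) := by
            gcongr
            exacts [hzC _, hQn z hzC s hs, hzC _]
        _ = (‖N‖ + Λ₁ * (δ * (‖c‖ + δ * C))) * C + (‖B (0, c)‖ + 1) := by ring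
        _ ≤ κ * C + (‖B (0, c)‖ + 1) := by gcongr
        _ = C := hC')
    (by
      intro z w hz hzC hw hwC D hD s hs
      have hD0 : 0 ≤ D := (norm_nonneg _).trans (hD 0)
      have h1 : ‖Q (X z s) - Q (X w s)‖ ≤ Λ₁ * (δ * D) := by
        have := hL₁.dist_le_mul _ (hmem₁ z hzC s hs) _ (hmem₁ w hwC s hs)
        rw [dist_eq_norm, dist_eq_norm] at this
        exact this.trans (by gcongr; exact hXl z w hz hw D hD s hs)
      have h2 : ‖B (X z s, V z s) - B (X w s, V w s)‖ ≤ Λ₂ * (δ * D) := by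
        have := hL₂.dist_le_mul _ (hmem₂ z hzC s hs) _ (hmem₂ w hwC s hs)
        rw [Prod.dist_eq, dist_eq_norm, dist_eq_norm, dist_eq_norm] at this
        refine this.trans ?_
        gcongr
        exact max_le (hXl z w hz hw D hD s hs) (hVl z w hz hw D hD s hs)
      calc _ = ‖N (z (a * s) - w (a * s)) + Q (X z s) (z s - w s) + ((Q (X z s) - Q (X w s)) (w s)
            + (B (X z s, V z s) - B (X w s, V w s)))‖ := by
            simp only [map_sub, sub_apply]; congr 1; abel
        _ ≤ ‖N‖ * ‖z (a * s) - w (a * s)‖ + ‖Q (X z s)‖ * ‖z s - w s‖ +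
            (‖Q (X z s) - Q (X w s)‖ * ‖w s‖ + ‖B (X z s, V z s) - B (X w s, V w s)‖) := by
            refine norm_add₃_le.trans (add_le_add (add_le_add ?_ ?_)
              ((norm_add_le _ _).trans (add_le_add ?_ le_rfl))) <;>
            exact ContinuousLinearMap.le_opNorm _ _
        _ ≤ ‖N‖ * D + (Λ₁ * (δ * (‖c‖ + δ * C))) * D + (Λ₁ * (δ * D) * C + Λ₂ * (δ * D)) := by
            gcongr
            exacts [hD _, hQn z hzC s hs, hD _, hwC _]
        _ = (‖N‖ + Λ₁ * (δ * (‖c‖ + δ * C)) + Λ₁ * δ * C + Λ₂ * δ) * D := by ring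
        _ ≤ κ * D := by gcongr)
  refine ⟨z, X z, V z, hz, by simp [X], by simp [V], hXd z hz, hVd z hz, ?_⟩
  filter_upwards [Icc_mem_nhds (neg_lt_zero.2 hδ) hδ] with s hs
  exact hzeq s (abs_le.2 hs)

lemma eventually_eq_zero_of_hasDerivAt {f f' : ℝ → E} (h0 : f 0 = 0)
    (hf : ∀ᶠ s in 𝓝 0, HasDerivAt f (f' s) s) (hf' : ∀ᶠ s in 𝓝 0, f' s = 0) :
    ∀ᶠ s in 𝓝 0, f s = 0 := by
  obtain ⟨δ, hδ, H⟩ := (eventually_forall_abs_le (hf.and hf')).exists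
  filter_upwards [Icc_mem_nhds (neg_lt_zero.2 hδ) hδ] with s hs
  have := Convex.norm_image_sub_le_of_norm_hasDerivWithin_le (C := 0) (f := f)
    (s := Icc (-δ) δ) (x := 0) (y := s)
    (fun t ht => (H t (abs_le.2 ht)).1.hasDerivWithinAt)
    (fun t ht => by rw [(H t (abs_le.2 ht)).2, norm_zero]) (convex_Icc _ _)
    (by constructor <;> linarith) hs
  rw [h0, sub_zero, zero_mul] at this
  exact norm_le_zero_iff.1 this

/-- A `C^r` map, `r ≥ 3`, with invertible differential `L` at the fixed point `0` has through `0`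
a `C^r` invariant curve `K` tangent to the eigenvector `c`, on which it is conjugate to
multiplication by `a`, provided that `a ^ 2 • L⁻¹` is a contraction. Differentiating
`F (K s) = K (a s)` twice turns the conjugacy into a contracting equation for `K''`, namely
`K'' s = a² L⁻¹ K'' (a s) + (1 - L⁻¹ DF(K)) K'' - L⁻¹ D²F(K)(K', K')`. No derivative is lost: this
is a linear equation for `K''` with coefficients built from `K` and `K'`, so each gain for `K''`
improves the coefficients, up to the class `C^(r-2)`. -/
theorem exists_invariant_curve [CompleteSpace E] {r : ℕ} (hr : 3 ≤ r) {F : E → E}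
    (hF : ContDiffAt ℝ r F 0) (hF0 : F 0 = 0) (L : E ≃L[ℝ] E) (hL : HasFDerivAt F (L : E →L[ℝ] E) 0)
    {a : ℝ} (ha : |a| < 1) (c : E) (hc : L c = a • c)
    (hN : ‖a ^ 2 • (L.symm : E →L[ℝ] E)‖ < 1) :
    ∃ K : ℝ → E, ContDiffAt ℝ r K 0 ∧ K 0 = 0 ∧ HasDerivAt K c 0 ∧
      ∀ᶠ s in 𝓝 0, F (K s) = K (a * s) := by
  obtain ⟨m, rfl⟩ : ∃ m, r = m + 2 := ⟨r - 2, by omega⟩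
  have hm : 1 ≤ m := by omega
  set Li : E →L[ℝ] E := (L.symm : E →L[ℝ] E) with hLi
  set D1 := fderiv ℝ F
  set D2 := fderiv ℝ D1
  have hD1s : ContDiffAt ℝ (m + 1 : ℕ) D1 0 := hF.fderiv_right (by push_cast; rw [add_assoc]; rfl)
  have hD2s : ContDiffAt ℝ m D2 0 := hD1s.fderiv_right (by push_cast; exact le_rfl)
  have hD10 : D1 0 = L := hL.fderiv
  let Q : E → E →L[ℝ] E := fun k => ContinuousLinearMap.id ℝ E - Li.comp (D1 k)
  let B : E × E → E := fun p => -Li (D2 p.1 p.2 p.2)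
  have hQs : ContDiffAt ℝ (m + 1 : ℕ) Q 0 := contDiffAt_const.sub (contDiffAt_const.clm_comp hD1s)
  have hBs : ContDiffAt ℝ m B (0, c) := by
    have h2 : ContDiffAt ℝ m (fun p : E × E => D2 p.1) (0, c) :=
      ContDiffAt.comp (g := D2) (f := Prod.fst) (0, c) hD2s contDiffAt_fst
    exact (Li.contDiff.contDiffAt.comp _
      ((h2.clm_apply contDiffAt_snd).clm_apply contDiffAt_snd)).neg
  have hQ0 : Q 0 = 0 := by
    ext v
    simp [Q, hD10, hLi]
  have h1m : (1 : WithTop ℕ∞) ≤ m := by exact_mod_cast hm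
  have h1m1 : (1 : WithTop ℕ∞) ≤ (m + 1 : ℕ) := by exact_mod_cast Nat.succ_pos m
  obtain ⟨z, K, V, hz, hK0, hV0, hKd, hVd, hzeq⟩ := exists_second_derivative_solution (a := a) c
    hN (hQs.of_le h1m1) hQ0 (hBs.of_le h1m)
  have hKev : ∀ {p : E → Prop}, (∀ᶠ x in 𝓝 0, p x) → ∀ᶠ s in 𝓝 (0 : ℝ), p (K s) := by
    intro p hp
    refine (hKd 0).continuousAt.eventually ?_
    rwa [hK0]
  -- smoothness: bootstrap in the equation for the second derivative
  have hreg : ∀ i : ℕ, i ≤ m → ContDiffAt ℝ i z 0 := by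
    intro i
    induction i with
    | zero => intro _; exact_mod_cast (contDiff_zero.2 hz).contDiffAt
    | succ i ih =>
      intro hi
      have hVs : ContDiffAt ℝ (i + 1 : ℕ) V 0 :=
        contDiffAt_succ_of_hasDerivAt (Eventually.of_forall hVd) (ih (by omega))
      have hKs : ContDiffAt ℝ (i + 1 : ℕ) K 0 :=
        contDiffAt_succ_of_hasDerivAt (Eventually.of_forall hKd)
          (hVs.of_le (by exact_mod_cast i.le_succ))
      have him : ((i + 1 : ℕ) : WithTop ℕ∞) ≤ m := by exact_mod_cast hi
      have him1 : ((i + 1 : ℕ) : WithTop ℕ∞) ≤ (m + 1 : ℕ) := by exact_mod_cast hi.trans m.le_succ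
      refine contDiffAt_solution ha (i + 1) (N := fun _ => a ^ 2 • Li) (P := fun s => Q (K s))
        (b := fun s => B (K s, V s)) contDiffAt_const ?_ ?_ (by simpa [hK0, hQ0] using hN)
        (contDiff_zero.2 hz).contDiffAt hzeq
      · exact ContDiffAt.comp (g := Q) 0 (by rw [hK0]; exact hQs.of_le him1) hKs
      · exact ContDiffAt.comp (g := B) (f := fun s => (K s, V s)) 0
          (by rw [hK0, hV0]; exact hBs.of_le him) (hKs.prodMk hVs)
  have hVs : ContDiffAt ℝ (m + 1 : ℕ) V 0 :=
    contDiffAt_succ_of_hasDerivAt (Eventually.of_forall hVd) (hreg m le_rfl)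
  refine ⟨K, contDiffAt_succ_of_hasDerivAt (Eventually.of_forall hKd) hVs, hK0, hV0 ▸ hKd 0, ?_⟩
  have hFd : ∀ᶠ s in 𝓝 (0 : ℝ), HasFDerivAt F (D1 (K s)) (K s) ∧
      HasFDerivAt D1 (D2 (K s)) (K s) := by
    refine hKev (p := fun x => HasFDerivAt F (D1 x) x ∧ HasFDerivAt D1 (D2 x) x) ?_
    filter_upwards [hF.eventually (ENat.natCast_ne_coe_top _), hD1s.eventually (by simp)]
      with x h1 h2
    exact ⟨(h1.differentiableAt (by positivity)).hasFDerivAt,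
      (h2.differentiableAt (by positivity)).hasFDerivAt⟩
  -- the defect of the conjugacy equation and its first derivative both vanish
  have hY' : ∀ᶠ s in 𝓝 0, D1 (K s) (V s) - a • V (a * s) = 0 := by
    refine eventually_eq_zero_of_hasDerivAt
      (f' := fun s => (D2 (K s) (V s) (V s) + D1 (K s) (z s)) - a • (a • z (a * s))) ?_ ?_ ?_
    · rw [hK0, mul_zero, hV0, hD10]
      simp [hc]
    · filter_upwards [hFd] with s hs
      exact ((hs.2.comp_hasDerivAt s (hKd s)).clm_apply (hVd s)).sub
        ((HasDerivAt.scomp s (hVd (a * s))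
          (by simpa using (hasDerivAt_id s).const_mul a)).const_smul a)
    · filter_upwards [hzeq] with s hs
      have h1 := congrArg L hs
      have hLLi : ∀ v, L (Li v) = v := fun v => L.apply_symm_apply v
      simp only [map_add, Q, B, sub_apply, map_sub, map_neg, ContinuousLinearMap.comp_apply,
        smul_apply, map_smul, hLLi, ContinuousLinearMap.id_apply] at h1
      rw [smul_smul, ← sq, sub_eq_zero]
      rw [← sub_eq_zero] at h1 ⊢
      rw [← h1]
      abel
  have hY : ∀ᶠ s in 𝓝 0, F (K s) - K (a * s) = 0 := by
    refine eventually_eq_zero_of_hasDerivAt (f' := fun s => D1 (K s) (V s) - a • V (a * s))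
      ?_ ?_ hY'
    · rw [mul_zero, hK0, hF0, sub_zero]
    · filter_upwards [hFd] with s hs
      exact (hs.1.comp_hasDerivAt s (hKd s)).sub
        (HasDerivAt.scomp s (hKd (a * s)) (by simpa using (hasDerivAt_id s).const_mul a))
  exact hY.mono fun s hs => sub_eq_zero.1 hs

/-! ### Germs of local diffeomorphisms and reversible maps -/

lemma eventually_comp_of_continuousAt {X Y : Type*} [TopologicalSpace X] [TopologicalSpace Y]
    {f : X → Y} {x : X} {y : Y} (hf : ContinuousAt f x) (hy : f x = y) {p : Y → Prop}
    (h : ∀ᶠ z in 𝓝 y, p z) : ∀ᶠ z in 𝓝 x, p (f z) :=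
  hf.eventually (hy ▸ h)

/-- `C` and `Φ` are mutually inverse germs at `0` of `C^k` diffeomorphisms fixing `0`. Both are
total functions; nothing is required of them away from `0`. -/
structure IsLocalDiffeo (k : ℕ) (C Φ : E → E) : Prop where
  contDiffAt : ContDiffAt ℝ k C 0
  contDiffAt_symm : ContDiffAt ℝ k Φ 0
  map_zero : C 0 = 0
  symm_map_zero : Φ 0 = 0
  left_inv : ∀ᶠ z in 𝓝 0, Φ (C z) = z
  right_inv : ∀ᶠ z in 𝓝 0, C (Φ z) = z

namespace IsLocalDiffeo

lemma symm {k : ℕ} {C Φ : E → E} (h : IsLocalDiffeo k C Φ) : IsLocalDiffeo k Φ C :=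
  ⟨h.2, h.1, h.4, h.3, h.6, h.5⟩

lemma of_le {k l : ℕ} {C Φ : E → E} (h : IsLocalDiffeo k C Φ) (hl : l ≤ k) :
    IsLocalDiffeo l C Φ :=
  ⟨h.1.of_le (by exact_mod_cast hl), h.2.of_le (by exact_mod_cast hl), h.3, h.4, h.5, h.6⟩

lemma eventually_map {k : ℕ} {C Φ : E → E} (h : IsLocalDiffeo k C Φ) {p : E → Prop}
    (hp : ∀ᶠ z in 𝓝 0, p z) : ∀ᶠ z in 𝓝 0, p (C z) :=
  eventually_comp_of_continuousAt h.contDiffAt.continuousAt h.map_zero hp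

lemma trans {k : ℕ} {C Φ C' Φ' : E → E} (h : IsLocalDiffeo k C Φ) (h' : IsLocalDiffeo k C' Φ') :
    IsLocalDiffeo k (C' ∘ C) (Φ ∘ Φ') where
  contDiffAt := ContDiffAt.comp 0 (by rw [h.map_zero]; exact h'.contDiffAt) h.contDiffAt
  contDiffAt_symm := 
    ContDiffAt.comp 0 (by rw [h'.symm_map_zero]; exact h.contDiffAt_symm) h'.contDiffAt_symm
  map_zero := by simp [h.map_zero, h'.map_zero]
  symm_map_zero := by simp [h.symm_map_zero, h'.symm_map_zero]
  left_inv := by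
    filter_upwards [h.left_inv, h.eventually_map h'.left_inv] with z h1 h2
    simp [h1, h2]
  right_inv := by
    filter_upwards [h'.right_inv, h'.symm.eventually_map h.right_inv] with z h1 h2
    simp [h1, h2]

end IsLocalDiffeo

lemma exists_isLocalDiffeo [CompleteSpace E] {k : ℕ} (hk : k ≠ 0) {C : E → E}
    (hC : ContDiffAt ℝ k C 0) (hC0 : C 0 = 0) {L : E ≃L[ℝ] E}
    (hL : HasFDerivAt C (L : E →L[ℝ] E) 0) :
    ∃ Φ, IsLocalDiffeo k C Φ ∧ HasFDerivAt Φ (L.symm : E →L[ℝ] E) 0 := by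
  have hk' : (k : WithTop ℕ∞) ≠ 0 := by exact_mod_cast hk
  have hs : HasStrictFDerivAt C (L : E →L[ℝ] E) 0 := hC.hasStrictFDerivAt' hL hk'
  refine ⟨hC.localInverse hL hk', ⟨hC, ?_, hC0, ?_, hs.eventually_left_inverse, ?_⟩, ?_⟩
  · have := hC.to_localInverse hL hk'
    rwa [hC0] at this
  · have := hs.localInverse_apply_image
    rwa [hC0] at this
  · have := hs.eventually_right_inverse
    rwa [hC0] at this
  · have := hs.to_localInverse.hasFDerivAt
    rwa [hC0] at this

/-- The germ `F` at `0` is of class `C^k`, fixes `0`, and is reversible with respect to the germ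
`ρ`, in the form `F ∘ ρ ∘ F = ρ`. That `ρ` is an involution is not part of the definition. -/
structure IsReversibleGerm (k : ℕ) (F ρ : E → E) : Prop where
  contDiffAt : ContDiffAt ℝ k F 0
  continuousAt_rev : ContinuousAt ρ 0
  map_zero : F 0 = 0
  rev_map_zero : ρ 0 = 0
  reversible : ∀ᶠ z in 𝓝 0, F (ρ (F z)) = ρ z

lemma IsLocalDiffeo.semiconj_symm {k : ℕ} {C Φ ρ σ : E → E} (h : IsLocalDiffeo k C Φ)
    (hρ : ContinuousAt ρ 0) (hρ0 : ρ 0 = 0) (hC : ∀ᶠ z in 𝓝 0, C (ρ z) = σ (C z)) :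
    ∀ᶠ z in 𝓝 0, Φ (σ z) = ρ (Φ z) := by
  filter_upwards [h.right_inv, h.symm.eventually_map hC, h.symm.eventually_map
    (eventually_comp_of_continuousAt hρ hρ0 h.left_inv)] with z h1 h2 h3
  rw [h1] at h2
  rw [← h2, h3]

lemma IsReversibleGerm.conj {k : ℕ} {F ρ σ C Φ : E → E} (hF : IsReversibleGerm k F ρ)
    (h : IsLocalDiffeo k C Φ) (hσ : ContinuousAt σ 0) (hσ0 : σ 0 = 0)
    (hC : ∀ᶠ z in 𝓝 0, C (ρ z) = σ (C z)) : IsReversibleGerm k (C ∘ F ∘ Φ) σ where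
  contDiffAt := by
    refine ContDiffAt.comp 0 ?_ (ContDiffAt.comp 0 ?_ h.contDiffAt_symm)
    · simpa [h.symm_map_zero, hF.map_zero] using h.contDiffAt
    · simpa [h.symm_map_zero] using hF.contDiffAt
  continuousAt_rev := hσ
  map_zero := by simp [h.symm_map_zero, hF.map_zero, h.map_zero]
  rev_map_zero := hσ0
  reversible := by
    have hs := h.semiconj_symm hF.continuousAt_rev hF.rev_map_zero hC
    have hFe := fun {p : E → Prop} =>
      eventually_comp_of_continuousAt (p := p) hF.contDiffAt.continuousAt hF.map_zero
    filter_upwards [h.symm.eventually_map hF.reversible, h.symm.eventually_map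
      (hFe (h.eventually_map hs)), h.symm.eventually_map (hFe h.left_inv), hs,
      eventually_comp_of_continuousAt hσ hσ0 h.right_inv] with z h1 h2 h3 h4 h5
    simp only [Function.comp_apply]
    rw [h2, h3, h1, ← h4, h5]

lemma continuousAt_swap_zero : ContinuousAt (Prod.swap : ℝ × ℝ → ℝ × ℝ) 0 :=
  continuous_swap.continuousAt

/-- The linear saddle `(x, y) ↦ (a x, a⁻¹ y)`. -/
noncomputable def saddleEquiv (a : ℝ) (ha : a ≠ 0) : (ℝ × ℝ) ≃L[ℝ] (ℝ × ℝ) :=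
  (ContinuousLinearEquiv.unitsEquivAut ℝ (Units.mk0 a ha)).prodCongr
    (ContinuousLinearEquiv.unitsEquivAut ℝ (Units.mk0 a ha)⁻¹)

lemma saddleEquiv_apply (a : ℝ) (ha : a ≠ 0) (p : ℝ × ℝ) :
    saddleEquiv a ha p = (a * p.1, a⁻¹ * p.2) := by
  simp [saddleEquiv, mul_comm]

lemma saddleEquiv_symm_apply (a : ℝ) (ha : a ≠ 0) (p : ℝ × ℝ) :
    (saddleEquiv a ha).symm p = (a⁻¹ * p.1, a * p.2) := by
  rw [ContinuousLinearEquiv.symm_apply_eq, saddleEquiv_apply]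
  simp [ha]

lemma norm_sq_smul_saddleEquiv_symm_lt_one {a : ℝ} (ha : a ≠ 0) (ha' : |a| < 1) :
    ‖a ^ 2 • ((saddleEquiv a ha).symm : (ℝ × ℝ) →L[ℝ] (ℝ × ℝ))‖ < 1 := by
  refine lt_of_le_of_lt (ContinuousLinearMap.opNorm_le_bound _ (abs_nonneg a) fun p => ?_) ha'
  have h : (a ^ 2 • ((saddleEquiv a ha).symm : (ℝ × ℝ) →L[ℝ] (ℝ × ℝ))) p =
      (a * p.1, a ^ 3 * p.2) := by
    rw [smul_apply, ContinuousLinearEquiv.coe_coe, saddleEquiv_symm_apply, Prod.smul_mk]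
    ext <;> simp <;> field_simp
  rw [h, Prod.norm_def, Prod.norm_def, Real.norm_eq_abs, Real.norm_eq_abs, abs_mul, abs_mul,
    abs_pow]
  have h3 : |a| ^ 3 ≤ |a| := pow_le_of_le_one (abs_nonneg a) ha'.le (by norm_num)
  refine max_le (by gcongr; exact le_max_left _ _) ?_
  gcongr
  exact le_max_right _ _

/-- Coordinates in which the involution `ρ` is the swap and the differential of `F` at `0` is
diagonal. If `v` is an eigenvector of `D = DF(0)` for `a` and `A = Dρ(0)`, then `D A D = A` makes
`A v` an eigenvector for `a⁻¹`, and `A` exchanges `v` and `A v`. In the basis `(v, A v)` the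
averaging `z ↦ (z + A ρ(z)) / 2` linearizes `ρ`. -/
theorem exists_linearizing_coordinates {k : ℕ} (hk : k ≠ 0) {F ρ : ℝ × ℝ → ℝ × ℝ}
    (hF : IsReversibleGerm k F ρ) (hρ : ContDiffAt ℝ k ρ 0) (hρρ : ∀ᶠ z in 𝓝 0, ρ (ρ z) = z)
    {a : ℝ} (ha : a ≠ 0) (ha' : |a| < 1) {v : ℝ × ℝ} (hv : v ≠ 0)
    (hav : fderiv ℝ F 0 v = a • v) :
    ∃ C Φ, IsLocalDiffeo k C Φ ∧ (∀ᶠ z in 𝓝 0, C (ρ z) = (C z).swap) ∧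
      HasFDerivAt (C ∘ F ∘ Φ) (saddleEquiv a ha : (ℝ × ℝ) →L[ℝ] (ℝ × ℝ)) 0 := by
  have hk' : (k : WithTop ℕ∞) ≠ 0 := by exact_mod_cast hk
  set D := fderiv ℝ F 0
  set A := fderiv ℝ ρ 0
  have hD : HasFDerivAt F D 0 := (hF.contDiffAt.differentiableAt hk').hasFDerivAt
  have hA : HasFDerivAt ρ A 0 := (hρ.differentiableAt hk').hasFDerivAt
  have hF0 := hF.map_zero
  have hρ0 := hF.rev_map_zero
  have hAA : ∀ w, A (A w) = w := by
    have h1 : HasFDerivAt (fun z => ρ (ρ z)) (A.comp A) 0 :=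
      HasFDerivAt.comp (g := ρ) 0 (by rwa [hρ0]) hA
    have h2 := (h1.congr_of_eventuallyEq (EventuallyEq.symm hρρ)).unique (hasFDerivAt_id 0)
    exact fun w => congrArg (fun T : (ℝ × ℝ) →L[ℝ] (ℝ × ℝ) => T w) h2
  have hDAD : ∀ w, D (A (D w)) = A w := by
    have h1 : HasFDerivAt (fun z => F (ρ (F z))) (D.comp (A.comp D)) 0 :=
      HasFDerivAt.comp (g := F) 0 (by rwa [hF0, hρ0])
        (HasFDerivAt.comp (g := ρ) 0 (by rwa [hF0]) hD)
    have h2 := (h1.congr_of_eventuallyEq (EventuallyEq.symm hF.reversible)).unique hA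
    exact fun w => congrArg (fun T : (ℝ × ℝ) →L[ℝ] (ℝ × ℝ) => T w) h2
  have haw : D (A v) = a⁻¹ • A v := by
    have := hDAD v
    rw [hav, map_smul, map_smul] at this
    conv_rhs => rw [← this, smul_smul, inv_mul_cancel₀ ha, one_smul]
  have hAv : A v ≠ 0 := fun h => hv (by rw [← hAA v, h, map_zero])
  let S₀ : (ℝ × ℝ) →ₗ[ℝ] (ℝ × ℝ) :=
    (LinearMap.fst ℝ ℝ ℝ).smulRight v + (LinearMap.snd ℝ ℝ ℝ).smulRight (A v)
  have hS₀ : ∀ p, S₀ p = p.1 • v + p.2 • A v := fun p => rfl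
  have hinj : Function.Injective S₀ := by
    refine (injective_iff_map_eq_zero _).2 fun p hp => ?_
    rw [hS₀] at hp
    have h2 := congrArg D hp
    rw [map_add, map_smul, map_smul, hav, haw, map_zero] at h2
    have h3 : (p.1 * (a - a⁻¹)) • v = 0 := by
      have : (p.1 * (a - a⁻¹)) • v =
          (p.1 • a • v + p.2 • a⁻¹ • A v) - a⁻¹ • (p.1 • v + p.2 • A v) := by module
      rw [this, hp, h2, smul_zero, sub_zero]
    have h4 : a - a⁻¹ ≠ 0 := by
      intro h
      have : a * a = 1 := by
        field_simp at h
        nlinarith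
      nlinarith [abs_mul_abs_self a, abs_nonneg a]
    have h5 : p.1 = 0 := by
      rcases smul_eq_zero.1 h3 with h | h
      · exact (mul_eq_zero.1 h).resolve_right h4
      · exact absurd h hv
    rw [h5, zero_smul, zero_add] at hp
    exact Prod.ext h5 ((smul_eq_zero.1 hp).resolve_right hAv)
  let S : (ℝ × ℝ) ≃L[ℝ] (ℝ × ℝ) := (LinearEquiv.ofInjectiveEndo S₀ hinj).toContinuousLinearEquiv
  have hS : ∀ p, S p = p.1 • v + p.2 • A v := fun p => rfl
  have hSswap : ∀ p, S p.swap = A (S p) := by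
    intro p
    simp only [hS, map_add, map_smul, hAA, Prod.fst_swap, Prod.snd_swap]
    abel
  have hSsymm : ∀ w, S.symm (A w) = (S.symm w).swap := by
    intro w
    rw [ContinuousLinearEquiv.symm_apply_eq, hSswap, ContinuousLinearEquiv.apply_symm_apply]
  let W : (ℝ × ℝ) →L[ℝ] (ℝ × ℝ) := (ContinuousLinearEquiv.prodComm ℝ ℝ ℝ : (ℝ × ℝ) →L[ℝ] (ℝ × ℝ))
  have hW : ∀ p, W p = p.swap := fun p => rfl
  let C : ℝ × ℝ → ℝ × ℝ := fun z => (1 / 2 : ℝ) • (S.symm z + W (S.symm (ρ z)))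
  have hCs : ContDiffAt ℝ k C 0 := by
    have h1 : ContDiffAt ℝ k (fun z => S.symm (ρ z)) 0 := S.symm.contDiff.contDiffAt.comp 0 hρ
    have h2 : ContDiffAt ℝ k (fun z => W (S.symm (ρ z))) 0 := W.contDiff.contDiffAt.comp 0 h1
    exact (S.symm.contDiff.contDiffAt.add h2).const_smul (1 / 2 : ℝ)
  have hC0 : C 0 = 0 := by simp [C, hρ0]
  have hCd : HasFDerivAt C (S.symm : (ℝ × ℝ) →L[ℝ] (ℝ × ℝ)) 0 := by
    have h1 : HasFDerivAt (fun z => S.symm (ρ z)) _ 0 :=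
      S.symm.hasFDerivAt.comp 0 hA
    have h2 : HasFDerivAt (fun z => W (S.symm (ρ z))) _ 0 := W.hasFDerivAt.comp 0 h1
    refine ((S.symm.hasFDerivAt.add h2).const_smul (1 / 2 : ℝ)).congr_fderiv ?_
    refine ContinuousLinearMap.ext fun w => ?_
    simp only [smul_apply, add_apply, ContinuousLinearMap.comp_apply,
      ContinuousLinearEquiv.coe_coe, hSsymm, hW, Prod.swap_swap]
    module
  obtain ⟨Φ, hΦ, hΦd⟩ := exists_isLocalDiffeo hk hCs hC0 hCd
  refine ⟨C, Φ, hΦ, ?_, ?_⟩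
  · filter_upwards [hρρ] with z hz
    simp only [C, hz, ← hW]
    rw [map_smul, map_add]
    simp only [hW, Prod.swap_swap]
    rw [add_comm]
  · have h1 : HasFDerivAt (C ∘ F ∘ Φ) _ 0 :=
      HasFDerivAt.comp (g := C) 0 (by rwa [Function.comp_apply, hΦ.symm_map_zero, hF0])
        (HasFDerivAt.comp (g := F) 0 (by rwa [hΦ.symm_map_zero]) hΦd)
    refine h1.congr_fderiv (ContinuousLinearMap.ext fun w => ?_)
    simp only [ContinuousLinearMap.comp_apply, ContinuousLinearEquiv.coe_coe,
      ContinuousLinearEquiv.symm_symm]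
    rw [ContinuousLinearEquiv.symm_apply_eq, saddleEquiv_apply, hS, hS, map_add, map_smul,
      map_smul, hav, haw]
    module

/-- Near the origin, `F` preserves the coordinate axes and is linear on them, with multipliers `a`
on the first and `a⁻¹` on the second. -/
def HasLinearAxes (F : ℝ × ℝ → ℝ × ℝ) (a : ℝ) : Prop :=
  (∀ᶠ x in 𝓝 (0 : ℝ), F (x, 0) = (a * x, 0)) ∧ ∀ᶠ y in 𝓝 (0 : ℝ), F (0, y) = (0, a⁻¹ * y)

/-- Coordinates, compatible with the swap, in which both invariant manifolds are the coordinate axes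
and the map is linear on them. With `K` the linearized stable curve, `(x, y) ↦ K x + swap (K y)` is
the change of variables: by reversibility `swap ∘ K` parametrizes the unstable curve. -/
theorem exists_straightening_coordinates {k : ℕ} (hk : 3 ≤ k) {F : ℝ × ℝ → ℝ × ℝ}
    (hF : IsReversibleGerm k F Prod.swap) {a : ℝ} (ha : a ≠ 0) (ha' : |a| < 1)
    (hD : HasFDerivAt F (saddleEquiv a ha : (ℝ × ℝ) →L[ℝ] (ℝ × ℝ)) 0) :
    ∃ C Φ, IsLocalDiffeo k C Φ ∧ (∀ᶠ z in 𝓝 0, C z.swap = (C z).swap) ∧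
      HasLinearAxes (C ∘ F ∘ Φ) a := by
  obtain ⟨K, hK, hK0, hKd, hKF⟩ := exists_invariant_curve hk hF.contDiffAt hF.map_zero
    (saddleEquiv a ha) hD ha' ((1, 0) : ℝ × ℝ) (by rw [saddleEquiv_apply]; simp)
    (norm_sq_smul_saddleEquiv_symm_lt_one ha ha')
  let W : (ℝ × ℝ) →L[ℝ] (ℝ × ℝ) := (ContinuousLinearEquiv.prodComm ℝ ℝ ℝ : (ℝ × ℝ) →L[ℝ] (ℝ × ℝ))
  have hW : ∀ p, W p = p.swap := fun p => rfl
  let Ψ : ℝ × ℝ → ℝ × ℝ := fun p => K p.1 + W (K p.2)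
  have h1s : ContDiffAt ℝ k (fun p : ℝ × ℝ => K p.1) 0 :=
    ContDiffAt.comp (g := K) (f := Prod.fst) (0 : ℝ × ℝ) hK contDiffAt_fst
  have h2s : ContDiffAt ℝ k (fun p : ℝ × ℝ => K p.2) 0 :=
    ContDiffAt.comp (g := K) (f := Prod.snd) (0 : ℝ × ℝ) hK contDiffAt_snd
  have hΨ : ContDiffAt ℝ k Ψ 0 := h1s.add (W.contDiff.contDiffAt.comp 0 h2s)
  have hΨ0 : Ψ 0 = 0 := by simp [Ψ, hK0]
  have hΨd : HasFDerivAt Ψ (ContinuousLinearEquiv.refl ℝ (ℝ × ℝ) : (ℝ × ℝ) →L[ℝ] (ℝ × ℝ)) 0 := by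
    have h1 : HasFDerivAt (fun p : ℝ × ℝ => K p.1) _ 0 :=
      HasFDerivAt.comp (g := K) (f := Prod.fst) (0 : ℝ × ℝ) hKd.hasFDerivAt hasFDerivAt_fst
    have h2 : HasFDerivAt (fun p : ℝ × ℝ => K p.2) _ 0 :=
      HasFDerivAt.comp (g := K) (f := Prod.snd) (0 : ℝ × ℝ) hKd.hasFDerivAt hasFDerivAt_snd
    refine (h1.add (W.hasFDerivAt.comp 0 h2)).congr_fderiv (ContinuousLinearMap.ext fun w => ?_)
    ext <;> simp [hW]
  obtain ⟨C, hC, -⟩ := exists_isLocalDiffeo (by omega) hΨ hΨ0 hΨd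
  refine ⟨C, Ψ, hC.symm, ?_, ?_, ?_⟩
  · refine hC.semiconj_symm (ρ := Prod.swap) (σ := Prod.swap) continuousAt_swap_zero rfl
      (Eventually.of_forall fun z => ?_)
    simp only [Ψ, ← hW]
    rw [map_add]
    simp only [hW, Prod.swap_swap, Prod.fst_swap, Prod.snd_swap]
    rw [add_comm]
  · have h3 : ∀ᶠ x in 𝓝 (0 : ℝ), C (Ψ (a * x, 0)) = (a * x, 0) :=
      eventually_comp_of_continuousAt (f := fun x : ℝ => ((a * x, 0) : ℝ × ℝ)) (by fun_prop)
        (by simp) hC.left_inv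
    have hΨx : ∀ x, Ψ (x, 0) = K x := fun x => by simp [Ψ, hK0]
    filter_upwards [h3, hKF] with x h3 h4
    rw [Function.comp_apply, Function.comp_apply, hΨx, h4, ← hΨx, h3]
  · have h3 : ∀ᶠ y in 𝓝 (0 : ℝ), C (Ψ (0, a⁻¹ * y)) = (0, a⁻¹ * y) :=
      eventually_comp_of_continuousAt (f := fun y : ℝ => ((0, a⁻¹ * y) : ℝ × ℝ)) (by fun_prop)
        (by simp) hC.left_inv
    have hΨy : ∀ y, Ψ (0, y) = (K y).swap := fun y => by simp [Ψ, hK0, hW]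
    have h5 : ∀ᶠ s in 𝓝 (0 : ℝ), F (F (K s)).swap = (K s).swap :=
      eventually_comp_of_continuousAt hKd.continuousAt hK0 hF.reversible
    filter_upwards [h3, eventually_comp_mul a⁻¹ hKF, eventually_comp_mul a⁻¹ h5] with y h3 h4 h5
    rw [h4, mul_inv_cancel_left₀ ha] at h5
    rw [Function.comp_apply, Function.comp_apply, hΨy, h5, ← hΨy, h3]

/-! ### Normalizing the transverse multiplier -/

/-- The multiplicative cohomological equation `β s * α (a s) = β (a s)`, solved without loss of
smoothness. The logarithm of `β` satisfies an additive equation which does not contract, but its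
derivative satisfies a contracting one; so `β` is the exponential of a primitive. -/
lemma exists_multiplicative_coboundary {j : ℕ} {a : ℝ} (ha : |a| < 1) {α : ℝ → ℝ}
    (hα : ContDiffAt ℝ (j + 1 : ℕ) α 0) (hα0 : α 0 = 1) :
    ∃ β : ℝ → ℝ, ContDiffAt ℝ (j + 1 : ℕ) β 0 ∧ β 0 = 1 ∧
      ∀ᶠ s in 𝓝 0, β s * α (a * s) = β (a * s) := by
  set c : ℝ → ℝ := fun s => Real.log (α (a * s)) with hc
  have hαa : ContDiffAt ℝ (j + 1 : ℕ) (fun s => α (a * s)) 0 :=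
    ContDiffAt.comp (g := α) (0 : ℝ) (by simpa using hα) (by fun_prop)
  have hcs : ContDiffAt ℝ (j + 1 : ℕ) c 0 := hαa.log (by simp [hα0])
  have hc's : ContDiffAt ℝ j (deriv c) 0 := hcs.derivWithin (by push_cast; exact le_rfl)
  have hN : ‖a • ContinuousLinearMap.id ℝ ℝ‖ + ‖(0 : ℝ →L[ℝ] ℝ)‖ < 1 := by
    rw [norm_smul, ContinuousLinearMap.norm_id, norm_zero, Real.norm_eq_abs]
    simpa using ha
  obtain ⟨v, hv, hveq⟩ := exists_linear_solution (a := a)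
    (N := fun _ => a • ContinuousLinearMap.id ℝ ℝ) (P := fun _ => 0) (b := fun s => -deriv c s)
    contDiffAt_const contDiffAt_const (hc's.neg.of_le (by simp)) hN
  have hvs : ContDiffAt ℝ j v 0 := contDiffAt_solution ha j contDiffAt_const contDiffAt_const
    hc's.neg hN (contDiff_zero.2 hv).contDiffAt hveq
  have hId := hasDerivAt_integral hv
  have hIs : ContDiffAt ℝ (j + 1 : ℕ) (fun s => ∫ t in (0 : ℝ)..s, v t) 0 :=
    contDiffAt_succ_of_hasDerivAt (Eventually.of_forall hId) hvs
  refine ⟨fun s => Real.exp (∫ t in (0 : ℝ)..s, v t), hIs.exp, by simp, ?_⟩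
  have hzero : ∀ᶠ s in 𝓝 (0 : ℝ),
      (∫ t in (0 : ℝ)..s, v t) - (∫ t in (0 : ℝ)..(a * s), v t) + c s = 0 := by
    refine eventually_eq_zero_of_hasDerivAt (f' := fun s => v s - a • v (a * s) + deriv c s)
      ?_ ?_ ?_
    · simp [hc, hα0]
    · filter_upwards [hcs.eventually (ENat.natCast_ne_coe_top _)] with s hs
      exact ((hId s).sub ((hId (a * s)).scomp s (by simpa using (hasDerivAt_id s).const_mul a))).add
        (hs.differentiableAt (by positivity)).hasDerivAt
    · filter_upwards [hveq] with s hs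
      rw [hs]
      simp
  have hpos : ∀ᶠ s in 𝓝 (0 : ℝ), 0 < α (a * s) :=
    hαa.continuousAt.eventually_const_lt (by simp [hα0])
  filter_upwards [hzero, hpos] with s h1 h2
  rw [← Real.exp_log h2, ← Real.exp_add]
  congr 1
  simp only [hc] at h1
  linarith

/-- Coordinates of the form `(x β(y), y β(x))`, in which `∂x̄/∂x = a` all along the `y`-axis. Here
one derivative is lost, as `β` is obtained from `∂x̄/∂x` on that axis. -/
theorem exists_normal_multiplier_coordinates {k : ℕ} (hk : k ≠ 0) {F : ℝ × ℝ → ℝ × ℝ}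
    (hF : IsReversibleGerm (k + 1) F Prod.swap) {a : ℝ} (ha : a ≠ 0) (ha' : |a| < 1)
    (hax : HasLinearAxes F a) :
    ∃ C Φ, IsLocalDiffeo k C Φ ∧ (∀ᶠ z in 𝓝 0, C z.swap = (C z).swap) ∧
      HasLinearAxes (C ∘ F ∘ Φ) a ∧
      ∀ᶠ y in 𝓝 (0 : ℝ), (fderiv ℝ (C ∘ F ∘ Φ) (0, y) (1, 0)).1 = a := by
  obtain ⟨j, rfl⟩ := Nat.exists_eq_succ_of_ne_zero hk
  rw [Nat.succ_eq_add_one] at *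
  have hi : ContDiffAt ℝ (j + 1 : ℕ) (fun y : ℝ => ((0, y) : ℝ × ℝ)) 0 := by fun_prop
  have hic : ContinuousAt (fun y : ℝ => ((0, y) : ℝ × ℝ)) 0 := hi.continuousAt
  have hFd : ∀ᶠ z in 𝓝 (0 : ℝ × ℝ), HasFDerivAt F (fderiv ℝ F z) z := by
    filter_upwards [hF.contDiffAt.eventually (ENat.natCast_ne_coe_top _)] with z hz
    exact (hz.differentiableAt (by positivity)).hasFDerivAt
  have hlinx : ∀ y : ℝ, HasDerivAt (fun x : ℝ => ((x, y) : ℝ × ℝ)) (1, 0) 0 := fun y =>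
    (hasDerivAt_id (0 : ℝ)).prodMk (hasDerivAt_const (0 : ℝ) y)
  set α : ℝ → ℝ := fun y => a⁻¹ * (fderiv ℝ F (0, y) (1, 0)).1 with hα
  have hαs : ContDiffAt ℝ (j + 1 : ℕ) α 0 := by
    have h1 : ContDiffAt ℝ (j + 1 : ℕ) (fderiv ℝ F) 0 :=
      hF.contDiffAt.fderiv_right (by push_cast; exact le_rfl)
    have h2 : ContDiffAt ℝ (j + 1 : ℕ) (fun y : ℝ => fderiv ℝ F (0, y)) 0 :=
      ContDiffAt.comp (g := fderiv ℝ F) (0 : ℝ) h1 hi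
    exact contDiffAt_const.mul (h2.clm_apply contDiffAt_const).fst
  have hα0 : α 0 = 1 := by
    have h1 : HasDerivAt (fun x : ℝ => F (x, 0)) (fderiv ℝ F (0, 0) (1, 0)) 0 :=
      HasFDerivAt.comp_hasDerivAt (l := F) 0 hFd.self_of_nhds (hlinx 0)
    have h2 : HasDerivAt (fun x : ℝ => ((a * x, 0) : ℝ × ℝ)) (a, 0) 0 :=
      HasDerivAt.prodMk (by simpa using (hasDerivAt_id (0 : ℝ)).const_mul a)
        (hasDerivAt_const (0 : ℝ) 0)
    have h3 := h1.unique (h2.congr_of_eventuallyEq hax.1)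
    simp [hα, h3, ha]
  obtain ⟨β, hβ, hβ0, hβe⟩ := exists_multiplicative_coboundary ha' hαs hα0
  have h1s : ContDiffAt ℝ (j + 1 : ℕ) (fun p : ℝ × ℝ => β p.1) 0 :=
    ContDiffAt.comp (g := β) (f := Prod.fst) (0 : ℝ × ℝ) hβ contDiffAt_fst
  have h2s : ContDiffAt ℝ (j + 1 : ℕ) (fun p : ℝ × ℝ => β p.2) 0 :=
    ContDiffAt.comp (g := β) (f := Prod.snd) (0 : ℝ × ℝ) hβ contDiffAt_snd
  have hβd : ∀ᶠ s in 𝓝 (0 : ℝ), HasDerivAt β (deriv β s) s := by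
    filter_upwards [hβ.eventually (ENat.natCast_ne_coe_top _)] with s hs
    exact (hs.differentiableAt (by positivity)).hasDerivAt
  have hβd0 := hβd.self_of_nhds
  let C : ℝ × ℝ → ℝ × ℝ := fun p => (p.1 * β p.2, p.2 * β p.1)
  have hCs : ContDiffAt ℝ (j + 1 : ℕ) C 0 :=
    (contDiffAt_fst.mul h2s).prodMk (contDiffAt_snd.mul h1s)
  have hC0 : C 0 = 0 := by simp [C]
  have hCx : ∀ x, C (x, 0) = (x, 0) := fun x => by simp [C, hβ0]
  have hCy : ∀ y, C (0, y) = (0, y) := fun y => by simp [C, hβ0]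
  have hCd : HasFDerivAt C (ContinuousLinearEquiv.refl ℝ (ℝ × ℝ) : (ℝ × ℝ) →L[ℝ] (ℝ × ℝ)) 0 := by
    have h1 : HasFDerivAt (fun p : ℝ × ℝ => β p.1) _ 0 := HasFDerivAt.comp (g := β) (f := Prod.fst)
      (0 : ℝ × ℝ) hβd.self_of_nhds.hasFDerivAt hasFDerivAt_fst
    have h2 : HasFDerivAt (fun p : ℝ × ℝ => β p.2) _ 0 := HasFDerivAt.comp (g := β) (f := Prod.snd)
      (0 : ℝ × ℝ) hβd.self_of_nhds.hasFDerivAt hasFDerivAt_snd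
    refine ((hasFDerivAt_fst.mul h2).prodMk (hasFDerivAt_snd.mul h1)).congr_fderiv
      (ContinuousLinearMap.ext fun w => ?_)
    ext <;> simp [hβ0]
  obtain ⟨Φ, hC, -⟩ := exists_isLocalDiffeo (by omega) hCs hC0 hCd
  have hCswap : ∀ᶠ z in 𝓝 (0 : ℝ × ℝ), C z.swap = (C z).swap := Eventually.of_forall fun z => rfl
  have hFj : IsReversibleGerm (j + 1) F Prod.swap :=
    ⟨hF.contDiffAt.of_le (by exact_mod_cast Nat.le_succ _), hF.2, hF.3, hF.4, hF.5⟩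
  set G := C ∘ F ∘ Φ with hG
  have hGC : ∀ᶠ z in 𝓝 0, G (C z) = C (F z) := by
    filter_upwards [hC.left_inv] with z hz
    simp only [hG, Function.comp_apply, hz]
  have hGx : ∀ᶠ x in 𝓝 (0 : ℝ), G (x, 0) = (a * x, 0) := by
    have h1 : ∀ᶠ x : ℝ in 𝓝 0, G (C (x, 0)) = C (F (x, 0)) :=
      eventually_comp_of_continuousAt (f := fun x : ℝ => ((x, 0) : ℝ × ℝ)) (by fun_prop) rfl hGC
    filter_upwards [h1, hax.1] with x h1 h2
    rwa [h2, hCx, hCx] at h1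
  have hGy : ∀ᶠ y in 𝓝 (0 : ℝ), G (0, y) = (0, a⁻¹ * y) := by
    have h1 : ∀ᶠ y : ℝ in 𝓝 0, G (C (0, y)) = C (F (0, y)) :=
      eventually_comp_of_continuousAt hic rfl hGC
    filter_upwards [h1, hax.2] with x h1 h2
    rwa [h2, hCy, hCy] at h1
  refine ⟨C, Φ, hC, hCswap, ⟨hGx, hGy⟩, ?_⟩
  have hGd : ∀ᶠ z in 𝓝 (0 : ℝ × ℝ), HasFDerivAt G (fderiv ℝ G z) z := by
    have := (hFj.conj hC continuousAt_swap_zero rfl hCswap).contDiffAt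
    filter_upwards [this.eventually (ENat.natCast_ne_coe_top _)] with z hz
    exact (hz.differentiableAt (by positivity)).hasFDerivAt
  have hβne : ∀ᶠ s in 𝓝 (0 : ℝ), β s ≠ 0 :=
    hβ.continuousAt.eventually_ne (by rw [hβ0]; exact one_ne_zero)
  filter_upwards [eventually_comp_of_continuousAt hic rfl hGd,
    eventually_comp_of_continuousAt hic rfl hFd,
    eventually_comp_of_continuousAt hic rfl hGC.eventually_nhds, hax.2, hGy.eventually_nhds, hβne,
    eventually_comp_mul a⁻¹ hβd, eventually_comp_mul a⁻¹ hβe]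
    with y hGd hFd hGC hFy hGy hβne hβd' hβe
  rw [mul_inv_cancel_left₀ ha] at hβe
  set D := fderiv ℝ G (0, y)
  -- the tangent direction to the `y`-axis does not contribute to the first component
  have hDy : (D (0, 1)).1 = 0 := by
    have h1 : HasDerivAt (fun t : ℝ => G (0, t)) (D (0, 1)) y :=
      HasFDerivAt.comp_hasDerivAt (l := G) y hGd
        ((hasDerivAt_const y (0 : ℝ)).prodMk (hasDerivAt_id y))
    have h2 : HasDerivAt (fun t : ℝ => ((0, a⁻¹ * t) : ℝ × ℝ)) (0, a⁻¹) y :=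
      (hasDerivAt_const y (0 : ℝ)).prodMk (by simpa using (hasDerivAt_id y).const_mul a⁻¹)
    rw [h1.unique (h2.congr_of_eventuallyEq hGy)]
  have hCl : HasDerivAt (fun x : ℝ => C (x, y)) (β y, y * deriv β 0) 0 := by
    have h1 : HasDerivAt (fun x : ℝ => x * β y) (β y) 0 := by
      simpa using (hasDerivAt_id (0 : ℝ)).mul_const (β y)
    exact h1.prodMk (hβd0.const_mul y)
  have hL : HasDerivAt (fun x : ℝ => (G (C (x, y))).1) (β y * (D (1, 0)).1) 0 := by
    have h1 : HasDerivAt (fun x : ℝ => G (C (x, y))) (D (β y, y * deriv β 0)) 0 :=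
      HasFDerivAt.comp_hasDerivAt (l := G) 0 (by rwa [hCy]) hCl
    have h2 : (β y, y * deriv β 0) =
        β y • ((1, 0) : ℝ × ℝ) + (y * deriv β 0) • ((0, 1) : ℝ × ℝ) := by simp
    have h3 := (hasFDerivAt_fst (p := G (C (0, y)))).comp_hasDerivAt (0 : ℝ) h1
    refine h3.congr_deriv ?_
    rw [h2, map_add, map_smul, map_smul]
    simp [hDy]
  have hFl : HasDerivAt (fun x : ℝ => F (x, y)) (fderiv ℝ F (0, y) (1, 0)) 0 :=
    HasFDerivAt.comp_hasDerivAt (l := F) 0 hFd (hlinx y)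
  have hR : HasDerivAt (fun x : ℝ => (C (F (x, y))).1) (a * α y * β (a⁻¹ * y)) 0 := by
    have h1 := (hasFDerivAt_fst (p := F (0, y))).comp_hasDerivAt (0 : ℝ) hFl
    have h2 := (hasFDerivAt_snd (p := F (0, y))).comp_hasDerivAt (0 : ℝ) hFl
    have h3 : HasDerivAt (fun x : ℝ => β ((F (x, y)).2)) _ 0 :=
      HasDerivAt.comp (h₂ := β) (0 : ℝ) (by simpa only [Function.comp_apply, hFy] using hβd') h2
    refine (h1.mul h3).congr_deriv ?_
    simp [hFy, hα, ha]
  have hLR : (fun x : ℝ => (G (C (x, y))).1) =ᶠ[𝓝 0] fun x => (C (F (x, y))).1 :=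
    eventually_comp_of_continuousAt (f := fun x : ℝ => ((x, y) : ℝ × ℝ)) (by fun_prop) rfl
      (hGC.mono fun z hz => congrArg Prod.fst hz)
  have := hL.unique (hR.congr_of_eventuallyEq hLR)
  have h5 : β y * (D (1, 0)).1 = β y * a := by
    rw [this, ← hβe]
    ring
  exact mul_left_cancel₀ hβne h5

/-! ### Division by monomials, normal form and cross-form -/

lemma eq_mul_integral_of_hasDerivAt {φ φ' : ℝ → ℝ} {δ : ℝ} (h0 : φ 0 = 0)
    (hφ : ∀ t, |t| ≤ δ → HasDerivAt φ (φ' t) t) (hc : ∀ t, |t| ≤ δ → ContinuousAt φ' t) {x : ℝ}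
    (hx : |x| ≤ δ) : φ x = x * ∫ s in (0 : ℝ)..1, φ' (s * x) := by
  have hs : ∀ s ∈ uIcc (0 : ℝ) 1, |s * x| ≤ δ := by
    intro s hs
    rw [uIcc_of_le zero_le_one] at hs
    rw [abs_mul, abs_of_nonneg hs.1]
    nlinarith [abs_nonneg x, hs.2]
  have hd : ∀ s ∈ uIcc (0 : ℝ) 1, HasDerivAt (fun s => φ (s * x)) (x * φ' (s * x)) s := by
    intro s h
    have h1 : HasDerivAt (fun s : ℝ => s * x) x s := by simpa using (hasDerivAt_id s).mul_const x
    exact ((hφ _ (hs s h)).comp s h1).congr_deriv (mul_comm _ _)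
  have hcont : ContinuousOn (fun s => x * φ' (s * x)) (uIcc (0 : ℝ) 1) := by
    intro s h
    have h1 : ContinuousAt (fun s => φ' (s * x)) s :=
      ContinuousAt.comp (g := φ') (hc _ (hs s h)) (by fun_prop)
    exact (continuousAt_const.mul h1).continuousWithinAt
  have := intervalIntegral.integral_eq_sub_of_hasDerivAt hd hcont.intervalIntegrable
  rw [intervalIntegral.integral_const_mul, one_mul, zero_mul, h0, sub_zero] at this
  exact this.symm

/-- Hadamard division by `x² y`: a `C³` function vanishing on the axes, with vanishing
`x`-derivative on the `y`-axis, is a continuous multiple of `x² y`. The factor is the integral mean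
`∫∫∫ s g_xxy (t s x, u y) du dt ds`. It is made globally continuous by composing `g_xxy` with a
retraction onto a square around the origin. -/
theorem exists_eq_mul_sq_mul {g : ℝ × ℝ → ℝ} (hg : ContDiffAt ℝ (3 : ℕ) g 0)
    (hx : ∀ᶠ x in 𝓝 (0 : ℝ), g (x, 0) = 0) (hy : ∀ᶠ y in 𝓝 (0 : ℝ), g (0, y) = 0)
    (hy' : ∀ᶠ y in 𝓝 (0 : ℝ), fderiv ℝ g (0, y) (1, 0) = 0) :
    ∃ h : ℝ × ℝ → ℝ, Continuous h ∧ ∀ᶠ p in 𝓝 0, g p = h p * (p.1 ^ 2 * p.2) := by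
  set g1 : ℝ × ℝ → ℝ := fun p => fderiv ℝ g p (1, 0) with hg1
  set g2 : ℝ × ℝ → ℝ := fun p => fderiv ℝ g1 p (1, 0) with hg2
  set g3 : ℝ × ℝ → ℝ := fun p => fderiv ℝ g2 p (0, 1) with hg3
  have step : ∀ {n : ℕ} {f : ℝ × ℝ → ℝ} (w : ℝ × ℝ), ContDiffAt ℝ (n + 1 : ℕ) f 0 →
      ContDiffAt ℝ n (fun p => fderiv ℝ f p w) 0 := fun w hf =>
    (hf.fderiv_right (by push_cast; exact le_rfl)).clm_apply contDiffAt_const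
  have hs1 : ContDiffAt ℝ (2 : ℕ) g1 0 := step _ hg
  have hs2 : ContDiffAt ℝ (1 : ℕ) g2 0 := step _ hs1
  have hs3 : ContDiffAt ℝ (0 : ℕ) g3 0 := step _ hs2
  have hd : ∀ {n : ℕ} {f : ℝ × ℝ → ℝ}, ContDiffAt ℝ (n + 1 : ℕ) f 0 →
      ∀ᶠ p in 𝓝 0, HasFDerivAt f (fderiv ℝ f p) p := by
    intro n f hf
    filter_upwards [hf.eventually (ENat.natCast_ne_coe_top _)] with p hp
    exact (hp.differentiableAt (by positivity)).hasFDerivAt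
  have hlinx : ∀ x y : ℝ, HasDerivAt (fun x : ℝ => ((x, y) : ℝ × ℝ)) (1, 0) x := fun x y =>
    (hasDerivAt_id x).prodMk (hasDerivAt_const x y)
  have hliny : ∀ x y : ℝ, HasDerivAt (fun y : ℝ => ((x, y) : ℝ × ℝ)) (0, 1) y := fun x y =>
    (hasDerivAt_const y x).prodMk (hasDerivAt_id y)
  -- a function vanishing on the `x`-axis has vanishing `x`-derivative there
  have hzero : ∀ {n : ℕ} {f : ℝ × ℝ → ℝ}, ContDiffAt ℝ (n + 1 : ℕ) f 0 →
      (∀ᶠ x in 𝓝 (0 : ℝ), f (x, 0) = 0) → ∀ᶠ x in 𝓝 (0 : ℝ), fderiv ℝ f (x, 0) (1, 0) = 0 := by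
    intro n f hf h0
    have h1 := eventually_comp_of_continuousAt (f := fun x : ℝ => ((x, 0) : ℝ × ℝ)) (x := 0)
      (by fun_prop) rfl (hd hf)
    filter_upwards [h1, h0.eventually_nhds] with x h1 h2
    have h3 : HasDerivAt (fun x : ℝ => f (x, 0)) (fderiv ℝ f (x, 0) (1, 0)) x :=
      HasFDerivAt.comp_hasDerivAt (l := f) x h1 (hlinx x 0)
    exact h3.unique ((hasDerivAt_const x (0 : ℝ)).congr_of_eventuallyEq h2)
  have hx2 : ∀ᶠ x in 𝓝 (0 : ℝ), g2 (x, 0) = 0 := hzero hs1 (hzero hg hx)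
  have hcont : ∀ᶠ p in 𝓝 0, ContinuousAt g3 p :=
    (hs3.eventually (ENat.natCast_ne_coe_top _)).mono fun p hp => hp.continuousAt
  obtain ⟨ε, hε, H⟩ := Metric.eventually_nhds_iff.1
    ((hd hg).and ((hd hs1).and ((hd hs2).and hcont)))
  obtain ⟨δ, ⟨hδ, HA⟩, hδε⟩ := ((eventually_forall_abs_le (hx2.and (hy.and hy'))).and
    (Ioo_mem_nhdsGT hε)).exists
  replace H : ∀ x y : ℝ, |x| ≤ δ → |y| ≤ δ → HasFDerivAt g (fderiv ℝ g (x, y)) (x, y) ∧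
      HasFDerivAt g1 (fderiv ℝ g1 (x, y)) (x, y) ∧ HasFDerivAt g2 (fderiv ℝ g2 (x, y)) (x, y) ∧
      ContinuousAt g3 (x, y) := fun x y hx hy =>
    H (y := (x, y)) (by
      rw [dist_zero_right, Prod.norm_def, max_lt_iff]
      exact ⟨hx.trans_lt hδε.2, hy.trans_lt hδε.2⟩)
  let c : ℝ → ℝ := fun s => max (-δ) (min s δ)
  have hc : Continuous c := by fun_prop
  have hcabs : ∀ s, |c s| ≤ δ := fun s =>
    abs_le.2 ⟨le_max_left _ _, max_le (by linarith) (min_le_right _ _)⟩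
  have hcid : ∀ s, |s| ≤ δ → c s = s := fun s hs => by
    rw [abs_le] at hs
    simp only [c, min_eq_left hs.2, max_eq_right hs.1]
  have hW : Continuous (fun p : ℝ × ℝ => g3 (c p.1, c p.2)) := by
    refine continuous_iff_continuousAt.2 fun p => ?_
    exact ContinuousAt.comp (g := g3) (f := fun p : ℝ × ℝ => (c p.1, c p.2))
      (H _ _ (hcabs _) (hcabs _)).2.2.2 (by fun_prop)
  set H3 : ℝ × ℝ → ℝ := fun p => ∫ u in (0 : ℝ)..1, g3 (c p.1, c (u * p.2)) with hH3
  have hH3c : Continuous H3 := by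
    refine intervalIntegral.continuous_parametric_intervalIntegral_of_continuous' ?_ _ _
    exact hW.comp (by fun_prop : Continuous fun q : (ℝ × ℝ) × ℝ => (q.1.1, q.2 * q.1.2))
  set H2 : ℝ × ℝ → ℝ := fun p => ∫ t in (0 : ℝ)..1, H3 (t * p.1, p.2) with hH2
  have hH2c : Continuous H2 := by
    refine intervalIntegral.continuous_parametric_intervalIntegral_of_continuous' ?_ _ _
    exact hH3c.comp (by fun_prop : Continuous fun q : (ℝ × ℝ) × ℝ => (q.2 * q.1.1, q.1.2))
  set H1 : ℝ × ℝ → ℝ := fun p => ∫ s in (0 : ℝ)..1, s * H2 (s * p.1, p.2) with hH1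
  have hH1c : Continuous H1 := by
    refine intervalIntegral.continuous_parametric_intervalIntegral_of_continuous' ?_ _ _
    exact continuous_snd.mul
      (hH2c.comp (by fun_prop : Continuous fun q : (ℝ × ℝ) × ℝ => (q.2 * q.1.1, q.1.2)))
  have hmul : ∀ {x : ℝ}, |x| ≤ δ → ∀ s ∈ uIcc (0 : ℝ) 1, |s * x| ≤ δ := by
    intro x hx s hs
    rw [uIcc_of_le zero_le_one] at hs
    rw [abs_mul, abs_of_nonneg hs.1]
    nlinarith [abs_nonneg x, hs.2]
  have e3 : ∀ x y : ℝ, |x| ≤ δ → |y| ≤ δ → g2 (x, y) = y * H3 (x, y) := by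
    intro x y hx hy
    rw [eq_mul_integral_of_hasDerivAt (φ := fun y => g2 (x, y)) (φ' := fun y => g3 (x, y)) (δ := δ)
      (HA x hx).1 (fun t ht => HasFDerivAt.comp_hasDerivAt (l := g2) t (H x t hx ht).2.2.1
        (hliny x t)) (fun t ht => ContinuousAt.comp (g := g3) (f := fun y => (x, y))
        (H x t hx ht).2.2.2 (by fun_prop)) hy]
    congr 1
    refine intervalIntegral.integral_congr fun u hu => ?_
    simp only [hcid x hx, hcid _ (hmul hy u hu)]
  have e2 : ∀ x y : ℝ, |x| ≤ δ → |y| ≤ δ → g1 (x, y) = x * (y * H2 (x, y)) := by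
    intro x y hx hy
    rw [eq_mul_integral_of_hasDerivAt (φ := fun x => g1 (x, y)) (φ' := fun x => g2 (x, y)) (δ := δ)
      (HA y hy).2.2 (fun t ht => HasFDerivAt.comp_hasDerivAt (l := g1) t (H t y ht hy).2.1
        (hlinx t y)) (fun t ht => ContinuousAt.comp (g := g2) (f := fun x => (x, y))
        (H t y ht hy).2.2.1.continuousAt (by fun_prop)) hx]
    simp only [hH2]
    congr 1
    rw [← intervalIntegral.integral_const_mul]
    refine intervalIntegral.integral_congr fun u hu => ?_
    exact e3 _ _ (hmul hx u hu) hy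
  have e1 : ∀ x y : ℝ, |x| ≤ δ → |y| ≤ δ → g (x, y) = x * ((x * y) * H1 (x, y)) := by
    intro x y hx hy
    rw [eq_mul_integral_of_hasDerivAt (φ := fun x => g (x, y)) (φ' := fun x => g1 (x, y)) (δ := δ)
      (HA y hy).2.1 (fun t ht => HasFDerivAt.comp_hasDerivAt (l := g) t (H t y ht hy).1
        (hlinx t y)) (fun t ht => ContinuousAt.comp (g := g1) (f := fun x => (x, y))
        (H t y ht hy).2.1.continuousAt (by fun_prop)) hx]
    simp only [hH1]
    congr 1
    rw [← intervalIntegral.integral_const_mul]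
    refine intervalIntegral.integral_congr fun u hu => ?_
    simp only [e2 _ _ (hmul hx u hu) hy]
    ring
  refine ⟨H1, hH1c, ?_⟩
  filter_upwards [Metric.closedBall_mem_nhds (0 : ℝ × ℝ) hδ] with p hp
  rw [mem_closedBall_zero_iff, Prod.norm_def, max_le_iff] at hp
  rw [← Prod.mk.eta (p := p), e1 _ _ hp.1 hp.2]
  ring

/-- The first component of `F` is `a x + h(x,y) x² y` near the origin, with `h` continuous on the
whole plane. -/
structure HasFirstFactor (F : ℝ × ℝ → ℝ × ℝ) (a : ℝ) (h : ℝ × ℝ → ℝ) : Prop where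
  continuous : Continuous h
  fst_eq : ∀ᶠ p in 𝓝 0, (F p).1 = a * p.1 + h p * (p.1 ^ 2 * p.2)

lemma exists_first_factor {F : ℝ × ℝ → ℝ × ℝ} (hF : ContDiffAt ℝ (3 : ℕ) F 0) {a : ℝ}
    (hax : HasLinearAxes F a)
    (hn : ∀ᶠ y in 𝓝 (0 : ℝ), (fderiv ℝ F (0, y) (1, 0)).1 = a) :
    ∃ h, HasFirstFactor F a h := by
  have hFd : ∀ᶠ p in 𝓝 (0 : ℝ × ℝ), HasFDerivAt F (fderiv ℝ F p) p := by
    filter_upwards [hF.eventually (ENat.natCast_ne_coe_top _)] with p hp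
    exact (hp.differentiableAt (by positivity)).hasFDerivAt
  obtain ⟨h, hc, hh⟩ := exists_eq_mul_sq_mul (g := fun p => (F p).1 - a * p.1)
    (hF.fst.sub (contDiffAt_const.mul contDiffAt_fst)) (hax.1.mono fun x hx => by simp [hx])
    (hax.2.mono fun y hy => by simp [hy]) (by
      filter_upwards [hn, eventually_comp_of_continuousAt (f := fun y : ℝ => ((0, y) : ℝ × ℝ))
        (x := 0) (by fun_prop) rfl hFd] with y h1 h2
      have h3 : HasFDerivAt (fun p => (F p).1 - a * p.1) _ ((0, y) : ℝ × ℝ) :=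
        h2.fst.sub (hasFDerivAt_fst.const_mul a)
      rw [h3.fderiv]
      simp [h1])
  exact ⟨h, hc, hh.mono fun p hp => by rw [← hp]; ring⟩

/-- Reversibility turns the formula for the first component into a relation for the second one:
`F` maps `(ȳ, x̄)` to `(y, x)`, so that `y = a ȳ + h(ȳ,x̄) ȳ² x̄`. -/
lemma HasFirstFactor.eventually_snd_eq {k : ℕ} {F : ℝ × ℝ → ℝ × ℝ}
    (hF : IsReversibleGerm k F Prod.swap) {a : ℝ} {h : ℝ × ℝ → ℝ} (hh : HasFirstFactor F a h) :
    ∀ᶠ p in 𝓝 0, p.2 = (F p).2 * (a + h (F p).swap * ((F p).2 * (F p).1)) := by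
  have h1 : ∀ᶠ p in 𝓝 0, (F (F p).swap).1 = a * (F p).swap.1 + h (F p).swap *
      ((F p).swap.1 ^ 2 * (F p).swap.2) :=
    eventually_comp_of_continuousAt (f := fun p => (F p).swap) (x := 0)
      (continuous_swap.continuousAt.comp hF.contDiffAt.continuousAt) (by simp [hF.map_zero])
      hh.fst_eq
  filter_upwards [h1, hF.reversible] with p h1 h2
  rw [h2] at h1
  simp only [Prod.fst_swap, Prod.snd_swap] at h1
  rw [h1]
  ring

theorem HasFirstFactor.exists_hasMainNormalForm {k : ℕ} {F : ℝ × ℝ → ℝ × ℝ}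
    (hF : IsReversibleGerm k F Prod.swap) {a : ℝ} (ha : a ≠ 0) {h : ℝ × ℝ → ℝ}
    (hh : HasFirstFactor F a h) :
    ∃ h₁ h₂ : ℝ × ℝ → ℝ, (∀ᶠ p in 𝓝 (0 : ℝ × ℝ), ContinuousAt h₁ p ∧ ContinuousAt h₂ p) ∧
      HasMainNormalForm F a h₁ h₂ ∧ h₁ 0 = -h₂ 0 := by
  have hc := hh.continuous
  let P : ℝ × ℝ → ℝ := fun p => a + h p * (p.1 * p.2)
  let Q : ℝ × ℝ → ℝ := fun p => (a + h (F p).swap * ((F p).2 * (F p).1))⁻¹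
  have hQ0 : (a + h (F 0).swap * ((F 0).2 * (F 0).1)) = a := by simp [hF.map_zero]
  have hFc : ∀ᶠ p in 𝓝 (0 : ℝ × ℝ), ContinuousAt F p :=
    (hF.contDiffAt.eventually (ENat.natCast_ne_coe_top _)).mono fun p hp => hp.continuousAt
  have hQd : ∀ {p : ℝ × ℝ}, ContinuousAt F p →
      ContinuousAt (fun p => a + h (F p).swap * ((F p).2 * (F p).1)) p := by
    intro p hp
    have h1 : ContinuousAt (fun p => h (F p).swap) p :=
      ContinuousAt.comp (g := fun q : ℝ × ℝ => h q.swap) (by fun_prop) hp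
    fun_prop
  have hQne : ∀ᶠ p in 𝓝 0, a + h (F p).swap * ((F p).2 * (F p).1) ≠ 0 :=
    (hQd hFc.self_of_nhds).eventually_ne (by rwa [hQ0])
  -- `x̄ = x P` and `ȳ = y Q`, the second by the reversed relation
  refine ⟨fun p => a⁻¹ * h p, fun p => -h (F p).swap * (Q p ^ 2 * P p), ?_, ?_, ?_⟩
  · filter_upwards [hFc, hQne] with p h1 h2
    have h3 : ContinuousAt Q p := (hQd h1).inv₀ h2
    have h4 : ContinuousAt (fun p => h (F p).swap) p :=
      ContinuousAt.comp (g := fun q : ℝ × ℝ => h q.swap) (by fun_prop) h1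
    exact ⟨by fun_prop, by fun_prop⟩
  · filter_upwards [hh.fst_eq, hh.eventually_snd_eq hF, hQne] with p h1 h2 h3
    have h4 : (F p).2 = p.2 * Q p := by
      simp only [Q]
      rw [eq_mul_inv_iff_mul_eq₀ h3, ← h2]
    have h5 : (F p).1 = p.1 * P p := by rw [h1]; ring
    refine Prod.ext ?_ ?_
    · simp only
      rw [h1]
      field_simp
    · have h6 : a * (F p).2 = p.2 - h (F p).swap * ((F p).2 ^ 2 * (F p).1) := by
        linear_combination -h2
      have h7 : (F p).2 = a⁻¹ * (p.2 - h (F p).swap * ((F p).2 ^ 2 * (F p).1)) := by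
        rw [← h6, inv_mul_cancel_left₀ ha]
      simp only
      rw [h7]
      generalize h (F p).swap = w
      rw [h4, h5]
      ring
  · simp only [Q, P, hF.map_zero]
    simp
    field_simp

/-- The cross-form. The relation `ȳ = F(x, y).2` is solved for `y = Y(x, ȳ)`, and the first
cross-form equation is obtained by writing `x² y` as a multiple of `x² ȳ`. The second equation is
the first one for the pair `(ȳ, x̄) ↦ (y, x)`. -/
theorem HasFirstFactor.exists_hasCrossForm {k : ℕ} (hk : k ≠ 0) {F : ℝ × ℝ → ℝ × ℝ}
    (hF : IsReversibleGerm k F Prod.swap) {a : ℝ} (ha : a ≠ 0) (hax : HasLinearAxes F a)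
    {h : ℝ × ℝ → ℝ} (hh : HasFirstFactor F a h) :
    ∃ g : ℝ × ℝ → ℝ, (∀ᶠ p in 𝓝 (0 : ℝ × ℝ), ContinuousAt g p) ∧ HasCrossForm F a g := by
  have hc := hh.continuous
  have hF0 := hF.map_zero
  have hFc : ∀ᶠ p in 𝓝 (0 : ℝ × ℝ), ContinuousAt F p :=
    (hF.contDiffAt.eventually (ENat.natCast_ne_coe_top _)).mono fun p hp => hp.continuousAt
  have hFd : HasFDerivAt F (fderiv ℝ F 0) 0 :=
    (hF.contDiffAt.differentiableAt (by exact_mod_cast hk)).hasFDerivAt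
  -- the map `(x, y) ↦ (x, a ȳ)` is tangent to the identity
  let P : ℝ × ℝ → ℝ × ℝ := fun p => (p.1, a * (F p).2)
  have hDx : (fderiv ℝ F 0 (1, 0)).2 = 0 := by
    have h1 : HasDerivAt (fun t : ℝ => F (t, 0)) (fderiv ℝ F 0 (1, 0)) 0 :=
      HasFDerivAt.comp_hasDerivAt (l := F) (0 : ℝ) hFd
        ((hasDerivAt_id (0 : ℝ)).prodMk (hasDerivAt_const (0 : ℝ) (0 : ℝ)))
    have h2 : HasDerivAt (fun t : ℝ => ((a * t, 0) : ℝ × ℝ)) (a, 0) 0 :=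
      HasDerivAt.prodMk (by simpa using (hasDerivAt_id (0 : ℝ)).const_mul a)
        (hasDerivAt_const (0 : ℝ) (0 : ℝ))
    rw [h1.unique (h2.congr_of_eventuallyEq hax.1)]
  have hDy : (fderiv ℝ F 0 (0, 1)).2 = a⁻¹ := by
    have h1 : HasDerivAt (fun t : ℝ => F (0, t)) (fderiv ℝ F 0 (0, 1)) 0 :=
      HasFDerivAt.comp_hasDerivAt (l := F) (0 : ℝ) hFd
        ((hasDerivAt_const (0 : ℝ) (0 : ℝ)).prodMk (hasDerivAt_id (0 : ℝ)))
    have h2 : HasDerivAt (fun t : ℝ => ((0, a⁻¹ * t) : ℝ × ℝ)) (0, a⁻¹) 0 :=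
      (hasDerivAt_const (0 : ℝ) (0 : ℝ)).prodMk
        (by simpa using (hasDerivAt_id (0 : ℝ)).const_mul a⁻¹)
    rw [h1.unique (h2.congr_of_eventuallyEq hax.2)]
  have hPd : HasFDerivAt P (ContinuousLinearEquiv.refl ℝ (ℝ × ℝ) : (ℝ × ℝ) →L[ℝ] (ℝ × ℝ)) 0 := by
    refine (hasFDerivAt_fst.prodMk (hFd.snd.const_mul a)).congr_fderiv
      (ContinuousLinearMap.ext fun w => ?_)
    have hw : w = w.1 • ((1, 0) : ℝ × ℝ) + w.2 • ((0, 1) : ℝ × ℝ) := by simp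
    have h2 : a * (fderiv ℝ F 0 w).2 = w.2 := by
      rw [hw, map_add, map_smul, map_smul]
      simp [hDx, hDy]
      field_simp
    ext
    · simp
    · simpa using h2
  obtain ⟨Φ, hΦ, -⟩ := exists_isLocalDiffeo hk (C := P)
    (contDiffAt_fst.prodMk (contDiffAt_const.mul hF.contDiffAt.snd)) (by simp [P, hF0]) hPd
  let Y : ℝ × ℝ → ℝ := fun q => (Φ (q.1, a * q.2)).2
  have hlin : ∀ q : ℝ × ℝ, ContinuousAt (fun q : ℝ × ℝ => ((q.1, a * q.2) : ℝ × ℝ)) q :=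
    fun q => by fun_prop
  have hYc : ∀ᶠ q in 𝓝 (0 : ℝ × ℝ), ContinuousAt Y q := by
    have := eventually_comp_of_continuousAt (hlin 0) (by simp)
      (hΦ.contDiffAt_symm.eventually (ENat.natCast_ne_coe_top _))
    filter_upwards [this] with q hq
    exact (ContinuousAt.comp (g := Φ) (f := fun q : ℝ × ℝ => ((q.1, a * q.2) : ℝ × ℝ))
      hq.continuousAt (hlin q)).snd
  have hY0 : Y 0 = 0 := by
    have := hΦ.symm_map_zero
    simp only [Y, Prod.fst_zero, Prod.snd_zero, mul_zero]
    rw [← Prod.zero_eq_mk, this, Prod.snd_zero]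
  have hYF : ∀ᶠ z in 𝓝 (0 : ℝ × ℝ), Y (z.1, (F z).2) = z.2 := by
    filter_upwards [hΦ.left_inv] with z hz
    exact congrArg Prod.snd hz
  have hFY : ∀ᶠ q in 𝓝 (0 : ℝ × ℝ), (F (q.1, Y q)).2 = q.2 := by
    filter_upwards [eventually_comp_of_continuousAt (hlin 0) (by simp) hΦ.right_inv] with q hq
    have h1 : (Φ (q.1, a * q.2)).1 = q.1 := (Prod.ext_iff.1 hq).1
    have h2 : a * (F (Φ (q.1, a * q.2))).2 = a * q.2 := (Prod.ext_iff.1 hq).2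
    have h3 : (q.1, Y q) = Φ (q.1, a * q.2) := Prod.ext h1.symm rfl
    rw [h3]
    exact mul_left_cancel₀ ha h2
  let Z : ℝ × ℝ → ℝ × ℝ := fun q => (q.1, Y q)
  have hZc : ∀ᶠ q in 𝓝 (0 : ℝ × ℝ), ContinuousAt Z q :=
    hYc.mono fun q hq => continuousAt_fst.prodMk hq
  have hZ0 : Z 0 = 0 := by simp [Z, hY0]
  -- the factor comes from `y = ȳ (a + h(ȳ,x̄) ȳ x̄)`
  let g : ℝ × ℝ → ℝ := fun q =>
    h (Z q) * (a + h (q.2, (F (Z q)).1) * (q.2 * (F (Z q)).1))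
  have hgF : ∀ᶠ z in 𝓝 (0 : ℝ × ℝ),
      (F z).1 = a * z.1 + g (z.1, (F z).2) * (z.1 ^ 2 * (F z).2) := by
    filter_upwards [hYF, hh.fst_eq, hh.eventually_snd_eq hF] with z h1 h2 h3
    have h4 : Z (z.1, (F z).2) = z := Prod.ext rfl h1
    simp only [g, h4]
    have h5 : h ((F z).2, (F z).1) = h (F z).swap := rfl
    rw [h5]
    conv_lhs => rw [h2, h3]
    ring
  have hFswap : ContinuousAt (fun z => (F z).swap) 0 :=
    continuous_swap.continuousAt.comp hF.contDiffAt.continuousAt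
  have hgF' : ∀ᶠ z in 𝓝 (0 : ℝ × ℝ),
      z.2 = a * (F z).2 + g ((F z).2, z.1) * (z.1 * (F z).2 ^ 2) := by
    filter_upwards [hF.reversible, eventually_comp_of_continuousAt hFswap (by simp [hF0]) hgF]
      with z h1 h2
    rw [h1] at h2
    simp only [Prod.fst_swap, Prod.snd_swap] at h2
    conv_lhs => rw [h2]
    ring
  refine ⟨g, ?_, ?_⟩
  · filter_upwards [hZc, eventually_comp_of_continuousAt hZc.self_of_nhds hZ0 hFc] with q h1 h2
    have h3 : ContinuousAt (fun q => F (Z q)) q := ContinuousAt.comp (g := F) h2 h1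
    have h4 : ContinuousAt (fun q => h (Z q)) q := ContinuousAt.comp (g := h) hc.continuousAt h1
    have h5 : ContinuousAt (fun q : ℝ × ℝ => h (q.2, (F (Z q)).1)) q :=
      ContinuousAt.comp (g := h) (f := fun q : ℝ × ℝ => (q.2, (F (Z q)).1)) hc.continuousAt
        (by fun_prop)
    fun_prop
  · have hcross : ContinuousAt (fun q : (ℝ × ℝ) × (ℝ × ℝ) => ((q.1.1, q.2.2) : ℝ × ℝ)) 0 := by
      fun_prop
    have hcrossZ : ContinuousAt (fun q : (ℝ × ℝ) × (ℝ × ℝ) => Z (q.1.1, q.2.2)) 0 :=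
      ContinuousAt.comp (g := Z) hZc.self_of_nhds hcross
    have i1 := eventually_comp_of_continuousAt (f := Prod.fst) (x := (0 : (ℝ × ℝ) × (ℝ × ℝ)))
      continuousAt_fst rfl (hgF.and hgF')
    have i2 := eventually_comp_of_continuousAt hcross rfl hFY
    have i3 := eventually_comp_of_continuousAt hcrossZ hZ0 (hgF.and hgF')
    filter_upwards [i1, i2, i3] with q h1 h2 h3
    constructor
    · intro hq
      rw [hq]
      exact h1
    · rintro ⟨h4, h5⟩
      have h6 : (Z (q.1.1, q.2.2)).1 = q.1.1 := rfl
      have h7 : (F (Z (q.1.1, q.2.2))).2 = q.2.2 := h2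
      rw [h6, h7, ← h4, ← h5] at h3
      have h8 : Z (q.1.1, q.2.2) = q.1 := Prod.ext rfl h3.2
      rw [h8] at h3 h7
      exact Prod.ext h3.1.symm h7.symm

/-! ### Passage from the plane to the surface -/

theorem exists_planar_normal_form {r : ℕ} (hr : 4 ≤ r) {F ρ : ℝ × ℝ → ℝ × ℝ}
    (hF : IsReversibleGerm r F ρ) (hρ : ContDiffAt ℝ r ρ 0) (hρρ : ∀ᶠ z in 𝓝 0, ρ (ρ z) = z)
    {a : ℝ} (ha : a ≠ 0) (ha' : |a| < 1) {v : ℝ × ℝ} (hv : v ≠ 0)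
    (hav : fderiv ℝ F 0 v = a • v) :
    ∃ C Φ, IsLocalDiffeo (r - 1) C Φ ∧ (∀ᶠ z in 𝓝 0, C (ρ (Φ z)) = z.swap) ∧
      (∀ᶠ z in 𝓝 0, (C ∘ F ∘ Φ) ((C ∘ F ∘ Φ) z).swap = z.swap) ∧
      (∃ h₁ h₂ : ℝ × ℝ → ℝ, (∀ᶠ p in 𝓝 (0 : ℝ × ℝ), ContinuousAt h₁ p ∧ ContinuousAt h₂ p) ∧
        HasMainNormalForm (C ∘ F ∘ Φ) a h₁ h₂ ∧ h₁ 0 = -h₂ 0) ∧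
      ∃ h : ℝ × ℝ → ℝ, (∀ᶠ p in 𝓝 (0 : ℝ × ℝ), ContinuousAt h p) ∧
        HasCrossForm (C ∘ F ∘ Φ) a h := by
  obtain ⟨k, rfl⟩ : ∃ k, r = k + 1 := ⟨r - 1, by omega⟩
  rw [Nat.add_sub_cancel]
  obtain ⟨C₁, Φ₁, h₁, hs₁, hd₁⟩ := exists_linearizing_coordinates (by omega) hF hρ hρρ ha ha' hv hav
  have hF₁ := hF.conj h₁ continuousAt_swap_zero rfl hs₁
  obtain ⟨C₂, Φ₂, h₂, hs₂, hx₂⟩ := exists_straightening_coordinates (by omega) hF₁ ha ha' hd₁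
  have hF₂ := hF₁.conj h₂ continuousAt_swap_zero rfl hs₂
  obtain ⟨C₃, Φ₃, h₃, hs₃, hx₃, hn₃⟩ :=
    exists_normal_multiplier_coordinates (k := k) (by omega) hF₂ ha ha' hx₂
  have hF₂' : IsReversibleGerm k (C₂ ∘ (C₁ ∘ F ∘ Φ₁) ∘ Φ₂) Prod.swap :=
    ⟨hF₂.1.of_le (by exact_mod_cast k.le_succ), hF₂.2, hF₂.3, hF₂.4, hF₂.5⟩
  have hF₃ := hF₂'.conj h₃ continuousAt_swap_zero rfl hs₃
  have hC := ((h₁.trans h₂).of_le k.le_succ).trans h₃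
  obtain ⟨h, hh⟩ := exists_first_factor (hF₃.contDiffAt.of_le (by norm_cast; omega)) hx₃ hn₃
  refine ⟨C₃ ∘ C₂ ∘ C₁, (Φ₁ ∘ Φ₂) ∘ Φ₃, hC, ?_, hF₃.reversible,
    hh.exists_hasMainNormalForm hF₃ ha, hh.exists_hasCrossForm (by omega) hF₃ ha hx₃⟩
  have hs : ∀ᶠ z in 𝓝 0, (C₃ ∘ C₂ ∘ C₁) (ρ z) = ((C₃ ∘ C₂ ∘ C₁) z).swap := by
    filter_upwards [hs₁, h₁.eventually_map hs₂, (h₁.trans h₂).eventually_map hs₃] with z e1 e2 e3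
    simp only [Function.comp_apply] at e3 ⊢
    rw [e1, e2, e3]
  filter_upwards [hC.symm.eventually_map hs, hC.right_inv] with z e1 e2
  rw [e1]
  exact congrArg Prod.swap e2

lemma IsLocalDiffeo.exists_openPartialHomeomorph {k : ℕ} {C Φ : E → E} (h : IsLocalDiffeo k C Φ) :
    ∃ g : OpenPartialHomeomorph E E, (0 : E) ∈ g.source ∧ ⇑g = C ∧ ⇑g.symm = Φ ∧
      ContDiffOn ℝ k C g.source ∧ ContDiffOn ℝ k Φ g.target := by
  have hk : (k : WithTop ℕ∞) ≠ (⊤ : ℕ∞) := ENat.natCast_ne_coe_top _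
  obtain ⟨W, hW, hWo, h0W⟩ := eventually_nhds_iff.1 ((h.contDiffAt.eventually hk).and h.left_inv)
  obtain ⟨V, hV, hVo, h0V⟩ :=
    eventually_nhds_iff.1 ((h.contDiffAt_symm.eventually hk).and h.right_inv)
  have hCW : ContDiffOn ℝ k C W := fun z hz => (hW z hz).1.contDiffWithinAt
  have hΦV : ContDiffOn ℝ k Φ V := fun z hz => (hV z hz).1.contDiffWithinAt
  exact ⟨{ toFun := C
           invFun := Φ
           source := W ∩ C ⁻¹' V
           target := V ∩ Φ ⁻¹' W
           map_source' := fun z hz => ⟨hz.2, by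
             rw [mem_preimage, (hW z hz.1).2]
             exact hz.1⟩
           map_target' := fun z hz => ⟨hz.2, by
             rw [mem_preimage, (hV z hz.1).2]
             exact hz.1⟩
           left_inv' := fun z hz => (hW z hz.1).2
           right_inv' := fun z hz => (hV z hz.1).2
           open_source := hCW.continuousOn.isOpen_inter_preimage hWo hVo
           open_target := hΦV.continuousOn.isOpen_inter_preimage hVo hWo
           continuousOn_toFun := hCW.continuousOn.mono inter_subset_left
           continuousOn_invFun := hΦV.continuousOn.mono inter_subset_left },
    ⟨h0W, by rw [mem_preimage, h.map_zero]; exact h0V⟩, rfl, rfl, hCW.mono inter_subset_left,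
    hΦV.mono inter_subset_left⟩

section Surfaces

variable {M : Type*} [TopologicalSpace M] [ChartedSpace (ℝ × ℝ) M]

/-- A germ of a `C^k` diffeomorphism of the plane, applied after the preferred chart at `O` centred
at the origin, gives local coordinates at `O`. -/
lemma exists_isLocalCoord {k : ℕ} [IsManifold 𝓘(ℝ, ℝ × ℝ) (k : WithTop ℕ∞) M] (O : M)
    {C Φ : ℝ × ℝ → ℝ × ℝ} (h : IsLocalDiffeo k C Φ) :
    ∃ e : OpenPartialHomeomorph M (ℝ × ℝ), IsLocalCoord k e O ∧
      (∀ z, e z = C (chartAt (ℝ × ℝ) O z - chartAt (ℝ × ℝ) O O)) ∧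
      ∀ p, e.symm p = (chartAt (ℝ × ℝ) O).symm (Φ p + chartAt (ℝ × ℝ) O O) := by
  set φ := chartAt (ℝ × ℝ) O
  obtain ⟨g, h0, hgC, hgΦ, hC, hΦ⟩ := h.exists_openPartialHomeomorph
  set c := φ O
  set G := (Homeomorph.subRight c).toOpenPartialHomeomorph ≫ₕ g with hG
  have hGC : ∀ z, G z = C (z - c) := fun z => by simp [hG, hgC]
  have hGΦ : ∀ p, G.symm p = Φ p + c := fun p => by simp [hG, hgΦ]
  have hGmem : G ∈ contDiffGroupoid (k : WithTop ℕ∞) 𝓘(ℝ, ℝ × ℝ) := by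
    rw [contDiffGroupoid, mem_groupoid_of_pregroupoid]
    constructor
    · show ContDiffOn ℝ k G (G.source ∩ range id)
      refine ContDiffOn.congr (f := fun z => C (z - c)) ?_ fun z _ => hGC z
      exact hC.comp (by fun_prop) fun z hz => by simpa [hG] using hz.1
    · show ContDiffOn ℝ k G.symm (G.target ∩ range id)
      refine ContDiffOn.congr (f := fun p => Φ p + c) ?_ fun z _ => hGΦ z
      exact (hΦ.add contDiffOn_const).mono fun z hz => by simpa [hG] using hz.1
  refine ⟨φ ≫ₕ G, ⟨?_, ?_, ?_⟩, fun z => hGC _, fun p => ?_⟩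
  · refine mem_maximalAtlas_iff.2 fun e' he' => ⟨?_, ?_⟩
    · rw [OpenPartialHomeomorph.trans_symm_eq_symm_trans_symm, OpenPartialHomeomorph.trans_assoc]
      exact StructureGroupoid.trans _ (StructureGroupoid.symm _ hGmem)
        (HasGroupoid.compatible (chart_mem_atlas _ O) he')
    · rw [← OpenPartialHomeomorph.trans_assoc]
      exact StructureGroupoid.trans _ (HasGroupoid.compatible he' (chart_mem_atlas _ O)) hGmem
  · rw [OpenPartialHomeomorph.trans_source]
    exact ⟨mem_chart_source _ O, by simpa [hG, c, φ] using h0⟩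
  · show G (φ O) = 0
    rw [hGC, sub_self, h.map_zero]
  · show φ.symm (G.symm p) = _
    rw [hGΦ]

/-- The map `T` written in the preferred chart at `O`, translated so that `O` is the origin. -/
noncomputable def centredChartMap (O : M) (T : M → M) : ℝ × ℝ → ℝ × ℝ := fun z =>
  inCoord (chartAt (ℝ × ℝ) O) T (z + chartAt (ℝ × ℝ) O O) - chartAt (ℝ × ℝ) O O

lemma centredChartMap_zero {O : M} {T : M → M} (hT : T O = O) : centredChartMap O T 0 = 0 := by
  simp [centredChartMap, inCoord, hT]

lemma contDiffAt_centredChartMap {k : ℕ} {O : M} {T : M → M} (hT : T O = O)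
    (h : ContMDiffAt 𝓘(ℝ, ℝ × ℝ) 𝓘(ℝ, ℝ × ℝ) (k : WithTop ℕ∞) T O) :
    ContDiffAt ℝ k (centredChartMap O T) 0 := by
  have h1 := (contMDiffAt_iff.1 h).2
  rw [hT] at h1
  have h2 : ContDiffAt ℝ k (inCoord (chartAt (ℝ × ℝ) O) T) (chartAt (ℝ × ℝ) O O) := by
    show ContDiffAt ℝ k (fun p => chartAt (ℝ × ℝ) O (T ((chartAt (ℝ × ℝ) O).symm p))) _
    simpa [mfld_simps, contDiffWithinAt_univ, Function.comp_def] using h1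
  refine ContDiffAt.sub ?_ contDiffAt_const
  exact ContDiffAt.comp (g := inCoord (chartAt (ℝ × ℝ) O) T) (0 : ℝ × ℝ) (by rwa [zero_add])
    (by fun_prop)

lemma continuousAt_chart_symm_add (O : M) :
    ContinuousAt (fun z => (chartAt (ℝ × ℝ) O).symm (z + chartAt (ℝ × ℝ) O O)) 0 := by
  refine ContinuousAt.comp (g := (chartAt (ℝ × ℝ) O).symm) ?_ (by fun_prop)
  rw [zero_add]
  exact (chartAt (ℝ × ℝ) O).continuousAt_symm (mem_chart_target _ O)

lemma eventually_symm_centredChartMap {O : M} {T : M → M} (hT : T O = O)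
    (hc : ContinuousAt T O) :
    ∀ᶠ z in 𝓝 (0 : ℝ × ℝ),
      (chartAt (ℝ × ℝ) O).symm (centredChartMap O T z + chartAt (ℝ × ℝ) O O) =
        T ((chartAt (ℝ × ℝ) O).symm (z + chartAt (ℝ × ℝ) O O)) := by
  have h1 : ∀ᶠ m in 𝓝 O, T m ∈ (chartAt (ℝ × ℝ) O).source :=
    eventually_comp_of_continuousAt hc hT (chart_source_mem_nhds _ O)
  filter_upwards [eventually_comp_of_continuousAt (continuousAt_chart_symm_add O) (by simp) h1]
    with z hz
  rw [centredChartMap, sub_add_cancel, inCoord, OpenPartialHomeomorph.left_inv _ hz]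

lemma fderiv_centredChartMap (O : M) (T : M → M) :
    fderiv ℝ (centredChartMap O T) 0 =
      fderiv ℝ (inCoord (chartAt (ℝ × ℝ) O) T) (chartAt (ℝ × ℝ) O O) := by
  unfold centredChartMap
  rw [fderiv_sub_const, fderiv_comp_add_right, zero_add]

lemma IsReversibleOn.iterate_rev_iterate {k : ℕ} {f R : M → M} {U : Set M}
    (h : IsReversibleOn k f R U) (n : ℕ) {z : M} (hz : ∀ i ≤ n, f^[i] z ∈ U) :
    f^[n] (R (f^[n] z)) = R z := by
  induction n with
  | zero => rfl
  | succ n ih =>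
    rw [Function.iterate_succ_apply, Function.iterate_succ_apply',
      h.reversible _ (hz n n.le_succ) (by
        rw [← Function.iterate_succ_apply' f]
        exact hz (n + 1) le_rfl)]
    exact ih fun i hi => hz i (hi.trans n.le_succ)

lemma IsReversibleOn.contMDiffAt_iterate {k : ℕ} {f R : M → M} {U : Set M}
    (h : IsReversibleOn k f R U) {O : M} (hU : ∀ i : ℕ, f^[i] O ∈ U) (n : ℕ) :
    ContMDiffAt 𝓘(ℝ, ℝ × ℝ) 𝓘(ℝ, ℝ × ℝ) (k : WithTop ℕ∞) f^[n] O := by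
  induction n with
  | zero => exact contMDiffAt_id
  | succ n ih =>
    rw [Function.iterate_succ']
    exact ContMDiffAt.comp O (h.contMDiffOn_map.contMDiffAt (h.isOpen.mem_nhds (hU n))) ih

end Surfaces

end ReversibleSaddle

theorem lemma1
    {M : Type*} [TopologicalSpace M] [ChartedSpace (ℝ × ℝ) M]
    (r : ℕ) (hr : 4 ≤ r) [IsManifold 𝓘(ℝ, ℝ × ℝ) (r : WithTop ℕ∞) M]
    -- a reversible map `f`, with involution `R`, of class `C^r` on `U`
    (f R : M → M) (U : Set M) (hf : ReversibleSaddle.IsReversibleOn r f R U)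
    -- a periodic point `O` (a fixed point if `n = 1`) on the line of fixed points of `R`
    (O : M) (n : ℕ) (hn : 0 < n) (hO : f^[n] O = O) (hU : ∀ k : ℕ, f^[k] O ∈ U)
    (hRO : R O = O) (hfix : ReversibleSaddle.IsCurveNear r {z ∈ U | R z = z} O)
    -- `O` is a saddle
    (a : ℝ) (ha : a ≠ 0) (ha' : |a| < 1)
    (hmul : ReversibleSaddle.IsMultiplier f^[n] O a)
    (hmul' : ReversibleSaddle.IsMultiplier f^[n] O a⁻¹) :
    ∃ e : OpenPartialHomeomorph M (ℝ × ℝ), ReversibleSaddle.IsLocalCoord (r - 1) e O ∧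
      -- the main normal form
      (∃ h₁ h₂ : ℝ × ℝ → ℝ,
        (∀ᶠ p in 𝓝 (0 : ℝ × ℝ), ContinuousAt h₁ p ∧ ContinuousAt h₂ p) ∧
        ReversibleSaddle.HasMainNormalForm (ReversibleSaddle.inCoord e f^[n]) a h₁ h₂ ∧
        h₁ 0 = -h₂ 0) ∧
      -- the involution becomes `(x, y) ↦ (y, x)`, and the map is reversible with respect to it
      (∀ᶠ p in 𝓝 (0 : ℝ × ℝ), ReversibleSaddle.inCoord e R p = p.swap) ∧
      (∀ᶠ p in 𝓝 (0 : ℝ × ℝ),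
        ReversibleSaddle.inCoord e f^[n] (ReversibleSaddle.inCoord e f^[n] p).swap = p.swap) ∧
      -- the cross-form
      (∃ h : ℝ × ℝ → ℝ,
        (∀ᶠ p in 𝓝 (0 : ℝ × ℝ), ContinuousAt h p) ∧
        ReversibleSaddle.HasCrossForm (ReversibleSaddle.inCoord e f^[n]) a h) := by
  open ReversibleSaddle in
  have hOU : O ∈ U := hU 0
  have hT := hf.contMDiffAt_iterate hU n
  have hR : ContMDiffAt 𝓘(ℝ, ℝ × ℝ) 𝓘(ℝ, ℝ × ℝ) (r : WithTop ℕ∞) R O :=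
    hf.contMDiffOn_rev.contMDiffAt (hf.isOpen.mem_nhds hOU)
  set F := centredChartMap O f^[n] with hF
  set ρ := centredChartMap O R with hρ
  have hF0 : F 0 = 0 := centredChartMap_zero hO
  have hρ0 : ρ 0 = 0 := centredChartMap_zero hRO
  have hFs : ContDiffAt ℝ r F 0 := contDiffAt_centredChartMap hO hT
  have hρs : ContDiffAt ℝ r ρ 0 := contDiffAt_centredChartMap hRO hR
  have hFsymm := eventually_symm_centredChartMap hO hT.continuousAt
  have hρsymm := eventually_symm_centredChartMap hRO hR.continuousAt
  have hσ := continuousAt_chart_symm_add O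
  have hrev : ∀ᶠ m in 𝓝 O, f^[n] (R (f^[n] m)) = R m := by
    have : ∀ᶠ m in 𝓝 O, ∀ i ∈ Set.Iic n, f^[i] m ∈ U :=
      (Filter.eventually_all_finite (Set.finite_Iic n)).2 fun i _ =>
        (hf.contMDiffAt_iterate hU i).continuousAt.eventually (hf.isOpen.mem_nhds (hU i))
    exact this.mono fun m hm => hf.iterate_rev_iterate n hm
  have hFrev : IsReversibleGerm r F ρ := by
    refine ⟨hFs, hρs.continuousAt, hF0, hρ0, ?_⟩
    filter_upwards [hFsymm, eventually_comp_of_continuousAt hFs.continuousAt hF0 hρsymm,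
      eventually_comp_of_continuousAt hσ (by simp) hrev] with z h1 h2 h3
    rw [hF, centredChartMap, inCoord, ← hF, h2, h1, h3]
    rfl
  have hρρ : ∀ᶠ z in 𝓝 0, ρ (ρ z) = z := by
    have h1 : ∀ᶠ m in 𝓝 O, R (R m) = m := by
      filter_upwards [hf.isOpen.mem_nhds hOU] with m hm using hf.involutive m hm
    have h2 : ∀ᶠ z in 𝓝 (0 : ℝ × ℝ), z + chartAt (ℝ × ℝ) O O ∈ (chartAt (ℝ × ℝ) O).target :=
      eventually_comp_of_continuousAt (f := fun z => z + chartAt (ℝ × ℝ) O O) (by fun_prop)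
        (zero_add _) (chart_target_mem_nhds _ O)
    filter_upwards [hρsymm, eventually_comp_of_continuousAt hσ (by simp) h1, h2] with z h3 h4 h5
    rw [hρ, centredChartMap, inCoord, ← hρ, h3, h4, OpenPartialHomeomorph.right_inv _ h5,
      add_sub_cancel_right]
  obtain ⟨v, hv⟩ := hmul.exists_hasEigenvector
  have hav : fderiv ℝ F 0 v = a • v := by
    rw [hF, fderiv_centredChartMap]
    exact hv.apply_eq_smul
  obtain ⟨C, Φ, hC, hswap, hrevC, hnf, hcf⟩ :=
    exists_planar_normal_form hr hFrev hρs hρρ ha ha' hv.2 hav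
  have : IsManifold 𝓘(ℝ, ℝ × ℝ) ((r - 1 : ℕ) : WithTop ℕ∞) M :=
    IsManifold.of_le (n := (r : WithTop ℕ∞)) (by exact_mod_cast Nat.sub_le r 1)
  obtain ⟨e, he, hee, hes⟩ := exists_isLocalCoord O hC
  have hcoord : ∀ T : M → M, inCoord e T = C ∘ centredChartMap O T ∘ Φ := fun T => by
    funext p
    rw [inCoord, hee, hes]
    rfl
  refine ⟨e, he, ?_, ?_, ?_, ?_⟩
  · rw [hcoord]; exact hnf
  · rw [hcoord]; exact hswap
  · rw [hcoord]; exact hrevC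
  · rw [hcoord]; exact hcf
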